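/- **Setting.** For each sample size $n$ a regression problem is given; all of its data ($p,\lambda_i,v_i,\theta,\sigma^2$ and the laws below) may depend on $n$. The covariate $x\in\mathbb R^p$ has the form $x=V\Lambda^{1/2}\eta$, where $V=[v_1,\dots,v_p]$ is orthogonal, $\Lambda=\mathrm{diag}(\lambda_1,\dots,\lambda_p)$ with $\lambda_1\ge\dots\ge\lambda_p>0$ (so $\Sigma:=\mathbb E[xx^T]=V\Lambda V^T$), and the components of $\eta$ are independent, $\sigma_x$-subgaussian ($\mathbb E e^{t\eta_i}\le e^{\sigma_x^2t^2/2}$ for all $t$), of mean zero and unit variance. The parameter $\theta\in\mathbb R^p\setminus\{0\}$ is random: the coordinates $\tilde\theta_i=v_i^T\theta$ have fixed absolute values and independent uniformly random signs, independent of the covariates. Given $\theta$, the training examples $(x_i,y_i)$, $i\le n$, are i.i.d. copies of $(x,y)$ with $\mathbb E[y\mid x]=x^T\theta$ and $\mathbb E[(y-x^T\theta)^2\mid x]=\sigma^2>0$. With $X=[x_1,\dots,x_n]^T$ and $y=(y_1,\dots,y_n)^T$, the ridge estimator with parameter $\lambda\ge0$ is $\hat\theta_\lambda=X^T(XX^T+n\lambda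 I)^\dagger y$ ($\dagger$ is the Moore–Penrose pseudoinverse). Given $X$, its standard risk is $\mathcal R(\hat\theta_\lambda)=\mathbb E_{\theta,y}\,\mathbb E_{x_\star}\bigl[(x_\star^T\hat\theta_\lambda-x_\star^T\theta)^2\bigr]$, with $x_\star$ an independent copy of $x$, and $\mathbb E_{\theta,y}\|\hat\theta_\lambda\|^2$ is its expected squared norm, the expectations being over $\theta$ and $y$ with $X$ fixed. For $0\le k<p$ let $r_k=\lambda_{k+1}^{-1}\sum_{i>k}\lambda_i$ and $R_k=\bigl(\sum_{i>k}\lambda_i\bigr)^2/\sum_{i>k}\lambda_i^2$, and let $k^*=k^*(b)=\inf\{k\ge0: r_k\ge bn\}$. Write $\|\theta_{k:\infty}\|^2_{\Sigma_{k:\infty}}=\sum_{i>k}\lambda_i\tilde\theta_i^2$ and $\|\theta_{0:k}\|^2_{\Sigma_{0:k}^{-1}}=\sum_{i\le k}\tilde\theta_i^2/\lambda_i$. **Condition 1 (with constant $b$).** $k^*(b)<\infty$ for all large $n$, and as $n\to\infty$ the quantities $\|\theta_{k^*:\infty}\|^2_{\Sigma_{k^*:\infty}}$, $\bigl(\lambda_{k^*+1}r_{k^*}/n\bigr)^2\|\theta_{0:k^*}\|^2_{\Sigma_{0:k^*}^{-1}}$,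 $k^*/n$ and $n/R_{k^*}$ all tend to $0$. **Theorem 5.** For all $b>1$ and $\sigma_x>0$ there are constants $C_1,C_2>0$ and $c>1$, depending only on $b$ and $\sigma_x$, such that the following holds for every sequence of regression problems as above that satisfies Condition 1 with constant $b$. For all sufficiently large $n$ (how large may depend on the sequence) and all $\delta\in(0,1)$ with $\ln(1/\delta)<n/c$, with probability at least $1-\delta$ over $X$, for every $\lambda\ge0$, $$\frac{\mathcal R(\hat\theta_\lambda)}{C_1}\le\|\theta_{k^*:\infty}\|^2_{\Sigma_{k^*:\infty}}+\frac{\lambda_{k^*+1}^2r_{k^*}^2+n^2\lambda^2}{n^2}\,\|\theta_{0:k^*}\|^2_{\Sigma_{0:k^*}^{-1}}+\sigma^2\left(\frac{k^*}{n}+\frac{n\sum_{i>k^*}\lambda_i^2}{(\lambda_{k^*+1}r_{k^*}+n\lambda)^2}\right)$$ and $$\frac{\mathbb E_{\theta,y}\|\hat\theta_\lambda\|^2}{C_2}\ge\sum_{i\le k^*}\left(\frac{\sigma^2}{\lambda_i}+n\tilde\theta_i^2\right)\min\left\{\frac1n,\frac{n\lambda_i^2}{(\lambda_{k^*+1}r_{k^*}+n\lambda)^2}\right\}+\frac{n\sigma^2\lambda_{k^*+1}r_{k^*}+n^2\sum_{j>k^*}\tilde\theta_j^2\lambda_j^2}{\lambda_{k^*+1}^2r_{k^*}^2+n^2\lambda^2}.$$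 -/

import Mathlib

open MeasureTheory ProbabilityTheory Filter Topology
open scoped BigOperators InnerProductSpace Matrix

noncomputable section

/-! ### Moore-Penrose pseudoinverse of a real matrix -/

/-- `B` satisfies the four Penrose equations for `A`. -/
structure IsMoorePenrose {m n : Type*} [Fintype m] [Fintype n]
    (A : Matrix m n ℝ) (B : Matrix n m ℝ) : Prop where
  mul_mul : A * B * A = A
  mul_mul' : B * A * B = B
  symm_left : (A * B)ᵀ = A * B
  symm_right : (B * A)ᵀ = B * A

/-- A Moore-Penrose pseudoinverse is unique. -/
theorem IsMoorePenrose.unique {m n : Type*} [Fintype m] [Fintype n]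
    {A : Matrix m n ℝ} {B C : Matrix n m ℝ}
    (hB : IsMoorePenrose A B) (hC : IsMoorePenrose A C) : B = C := by
  have h1 : A * B = A * C := by
    calc A * B = (A * C * A) * B := by rw [hC.mul_mul]
      _ = (A * C)ᵀ * (A * B)ᵀ := by rw [hC.symm_left, hB.symm_left]; simp only [Matrix.mul_assoc]
      _ = ((A * B * A) * C)ᵀ := by rw [← Matrix.transpose_mul]; simp only [Matrix.mul_assoc]
      _ = A * C := by rw [hB.mul_mul, hC.symm_left]
  have h2 : B * A = C * A := by
    calc B * A = B * (A * C * A) := by rw [hC.mul_mul]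
      _ = (B * A)ᵀ * (C * A)ᵀ := by rw [hC.symm_right, hB.symm_right]; simp only [Matrix.mul_assoc]
      _ = (C * (A * B * A))ᵀ := by rw [← Matrix.transpose_mul]; simp only [Matrix.mul_assoc]
      _ = C * A := by rw [hB.mul_mul, hC.symm_right]
  calc B = B * A * B := hB.mul_mul'.symm
    _ = C * (A * B) := by rw [h2, Matrix.mul_assoc]
    _ = C := by rw [h1, ← Matrix.mul_assoc, hC.mul_mul']

/-- A real symmetric matrix has a Moore-Penrose pseudoinverse. -/
theorem exists_isMoorePenrose {n : Type*} [Fintype n] [DecidableEq n]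
    {A : Matrix n n ℝ} (hA : A.IsHermitian) : ∃ B, IsMoorePenrose A B := by
  set U : Matrix n n ℝ := (hA.eigenvectorUnitary : Matrix n n ℝ)
  set d : n → ℝ := hA.eigenvalues
  have hU : star U * U = 1 := Unitary.coe_star_mul_self hA.eigenvectorUnitary
  have key : ∀ M N : Matrix n n ℝ, U * M * star U * (U * N * star U) = U * (M * N) * star U := by
    intro M N
    calc U * M * star U * (U * N * star U) = U * M * (star U * U) * N * star U := by
          simp only [Matrix.mul_assoc]
      _ = _ := by rw [hU]; simp only [Matrix.mul_assoc, Matrix.mul_one]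
  have hAd : A = U * Matrix.diagonal d * star U := by
    have h := hA.spectral_theorem
    rw [Unitary.conjStarAlgAut_apply] at h
    exact h
  have hT : ∀ e : n → ℝ, (U * Matrix.diagonal e * star U)ᵀ = U * Matrix.diagonal e * star U := by
    intro e
    simp [Matrix.transpose_mul, Matrix.star_eq_conjTranspose, Matrix.mul_assoc]
  refine ⟨U * Matrix.diagonal (fun i => (d i)⁻¹) * star U, ?_, ?_, ?_, ?_⟩
  · rw [hAd]
    simp only [key, Matrix.diagonal_mul_diagonal, mul_inv_mul_cancel]
  · rw [hAd]
    simp only [key, Matrix.diagonal_mul_diagonal]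
    congr 3
    funext i
    simpa using mul_inv_mul_cancel (d i)⁻¹
  · rw [hAd]
    simp only [key, Matrix.diagonal_mul_diagonal, hT]
  · rw [hAd]
    simp only [key, Matrix.diagonal_mul_diagonal, hT]

open Classical in
/-- The Moore-Penrose pseudoinverse (unique, and it exists for every symmetric matrix). -/
def mpInverse {m n : Type*} [Fintype m] [Fintype n] (A : Matrix m n ℝ) : Matrix n m ℝ :=
  if h : ∃ B, IsMoorePenrose A B then h.choose else 0

/-! ### The regression model -/

/-- The vector obtained from `θ` by flipping the signs of its coordinates in the orthonormal
basis `v` according to the sign pattern `s`. -/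
def signFlip {p : ℕ} (v : OrthonormalBasis (Fin p) ℝ (EuclideanSpace ℝ (Fin p)))
    (θ : EuclideanSpace ℝ (Fin p)) (s : Fin p → ℤˣ) : EuclideanSpace ℝ (Fin p) :=
  ∑ j, (((s j : ℤ) : ℝ) * ⟪v j, θ⟫_ℝ) • v j

/-- The population of a random-sign linear regression problem with `σx`-subgaussian design.
The index `j : Fin p` stands for the index `j + 1` of the mathematical text. -/
structure RegressionModel (σx : ℝ) where
  /-- The dimension. -/
  p : ℕ
  /-- The law of a covariate vector `x`. -/
  law : Measure (EuclideanSpace ℝ (Fin p))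
  isProb : IsProbabilityMeasure law
  /-- The eigenvalues of the second moment matrix, in non-increasing order. -/
  eigval : Fin p → ℝ
  eigval_pos : ∀ j, 0 < eigval j
  eigval_antitone : Antitone eigval
  /-- The eigenvectors (the columns of `V`). -/
  eigvec : OrthonormalBasis (Fin p) ℝ (EuclideanSpace ℝ (Fin p))
  /-- The components `⟪v j, x⟫ / √(λ j)` of `η = Λ^(-1/2) Vᵀ x`, for which `x = V Λ^(1/2) η`, are
  independent, centred, of unit variance, and `σx`-subgaussian. -/
  indep : iIndepFun (fun j x => ⟪eigvec j, x⟫_ℝ / √(eigval j)) law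
  mean_zero : ∀ j, ∫ x, ⟪eigvec j, x⟫_ℝ / √(eigval j) ∂law = 0
  unit_var : ∀ j, ∫ x, (⟪eigvec j, x⟫_ℝ / √(eigval j)) ^ 2 ∂law = 1
  subgaussian : ∀ j,
    HasSubgaussianMGF (fun x => ⟪eigvec j, x⟫_ℝ / √(eigval j)) (Real.toNNReal (σx ^ 2)) law
  /-- The parameter up to the signs of its coordinates in the eigenbasis. -/
  θ : EuclideanSpace ℝ (Fin p)
  θ_ne_zero : θ ≠ 0
  /-- The variance `σ²` of the labels given the covariates. -/
  noiseVar : ℝ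
  noiseVar_pos : 0 < noiseVar
  /-- The conditional law of a label `y` given the covariate `x`, when the true parameter is
  `signFlip eigvec θ s`. -/
  label : (Fin p → ℤˣ) → Kernel (EuclideanSpace ℝ (Fin p)) ℝ
  label_markov : ∀ s, IsMarkovKernel (label s)
  label_memLp : ∀ s, ∀ᵐ x ∂law, MemLp id 2 (label s x)
  label_mean : ∀ s, ∀ᵐ x ∂law, ∫ y, y ∂(label s x) = ⟪x, signFlip eigvec θ s⟫_ℝ
  label_var : ∀ s, ∀ᵐ x ∂law,
    ∫ y, (y - ⟪x, signFlip eigvec θ s⟫_ℝ) ^ 2 ∂(label s x) = noiseVar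

namespace RegressionModel

variable {σx : ℝ} (M : RegressionModel σx)

/-- The law of the `n` i.i.d. training covariates `X = (x₁, …, xₙ)`. -/
def designLaw (n : ℕ) : Measure (Fin n → EuclideanSpace ℝ (Fin M.p)) :=
  Measure.pi fun _ => M.law

/-- The random parameter for the sign pattern `s`. -/
def param (s : Fin M.p → ℤˣ) : EuclideanSpace ℝ (Fin M.p) := signFlip M.eigvec M.θ s

/-- The conditional law of the label vector `y` given the training covariates `X` and the sign
pattern `s`; the pairs `(xᵢ, yᵢ)` are independent given the parameter. -/
def labelLaw {n : ℕ} (s : Fin M.p → ℤˣ) (X : Fin n → EuclideanSpace ℝ (Fin M.p)) :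
    Measure (Fin n → ℝ) :=
  Measure.pi fun i => M.label s (X i)

/-- The standard risk, given the training covariates `X`, of an estimator that maps the label
vector `y` to `est y`: the excess mean squared error `E_x (xᵀ est - xᵀ θ)²`, averaged over the
labels and over independent uniform signs of the coordinates of the parameter. -/
def stdRisk {n : ℕ} (X : Fin n → EuclideanSpace ℝ (Fin M.p))
    (est : (Fin n → ℝ) → EuclideanSpace ℝ (Fin M.p)) : ℝ :=
  𝔼 s : Fin M.p → ℤˣ,
    ∫ y, (∫ x, (⟪x, est y⟫_ℝ - ⟪x, M.param s⟫_ℝ) ^ 2 ∂M.law) ∂(M.labelLaw s X)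

/-- The expected squared norm, given the training covariates `X`, of an estimator: the average
of `‖est y‖²` over the labels and over the signs of the coordinates of the parameter. -/
def sqNorm {n : ℕ} (X : Fin n → EuclideanSpace ℝ (Fin M.p))
    (est : (Fin n → ℝ) → EuclideanSpace ℝ (Fin M.p)) : ℝ :=
  𝔼 s : Fin M.p → ℤˣ, ∫ y, ‖est y‖ ^ 2 ∂(M.labelLaw s X)

/-- `M.ev k` is `λ_{k+1}`, for `k < p` (and zero otherwise). -/
def ev (k : ℕ) : ℝ := if h : k < M.p then M.eigval ⟨k, h⟩ else 0

/-- The coordinate `(Vᵀ θ)_j`; its square does not depend on the random signs. -/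
def coef (j : Fin M.p) : ℝ := ⟪M.eigvec j, M.θ⟫_ℝ

/-- The indices `i ≤ k` of the mathematical text. -/
def head (k : ℕ) : Finset (Fin M.p) := Finset.univ.filter fun j => (j : ℕ) < k

/-- The indices `i > k` of the mathematical text. -/
def tail (k : ℕ) : Finset (Fin M.p) := Finset.univ.filter fun j => k ≤ (j : ℕ)

/-- The effective rank `r_k = (∑_{i>k} λ_i) / λ_{k+1}`, for `k < p`. -/
def effRank (k : ℕ) : ℝ := (∑ j ∈ M.tail k, M.eigval j) / M.ev k

/-- The effective rank `R_k = (∑_{i>k} λ_i)² / ∑_{i>k} λ_i²`, for `k < p`. -/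
def effRank' (k : ℕ) : ℝ := (∑ j ∈ M.tail k, M.eigval j) ^ 2 / ∑ j ∈ M.tail k, M.eigval j ^ 2

/-- The indices `k` for which `r_k` is defined and `r_k ≥ b n`. -/
def critSet (b : ℝ) (n : ℕ) : Set ℕ := {k | k < M.p ∧ b * n ≤ M.effRank k}

/-- The critical index `k*(b)` (meaningful when `critSet` is non-empty). -/
def critIndex (b : ℝ) (n : ℕ) : ℕ := sInf (M.critSet b n)

/-- `‖θ_{k:∞}‖²` in the norm of `Σ_{k:∞}`. -/
def tailNormSq (k : ℕ) : ℝ := ∑ j ∈ M.tail k, M.eigval j * M.coef j ^ 2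

/-- `‖θ_{0:k}‖²` in the norm of `Σ_{0:k}⁻¹`. -/
def headNormSq (k : ℕ) : ℝ := ∑ j ∈ M.head k, M.coef j ^ 2 / M.eigval j

end RegressionModel

/-- The ridge estimator `Xᵀ (X Xᵀ + n lam I)^† y`, where `X` has the rows `x₁, …, xₙ`. -/
def ridge {n p : ℕ} (X : Fin n → EuclideanSpace ℝ (Fin p)) (lam : ℝ) (y : Fin n → ℝ) :
    EuclideanSpace ℝ (Fin p) :=
  let D : Matrix (Fin n) (Fin p) ℝ := Matrix.of fun i j => X i j
  WithLp.toLp 2 (Dᵀ *ᵥ (mpInverse (D * Dᵀ + ((n : ℝ) * lam) • (1 : Matrix (Fin n) (Fin n) ℝ)) *ᵥ y))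

/-- The benign overfitting condition with constant `b` for a sequence of regression problems, the
`n`-th of which has sample size `n`. The first clause says that `k*(b) < ∞` for large `n`. -/
structure BenignOverfitting {σx : ℝ} (M : ℕ → RegressionModel σx) (b : ℝ) : Prop where
  crit_nonempty : ∀ᶠ n in atTop, ((M n).critSet b n).Nonempty
  tail_tendsto :
    Tendsto (fun n : ℕ => (M n).tailNormSq ((M n).critIndex b n)) atTop (𝓝 0)
  head_tendsto :
    Tendsto (fun n : ℕ =>
      ((M n).ev ((M n).critIndex b n) * (M n).effRank ((M n).critIndex b n) / n) ^ 2 *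
        (M n).headNormSq ((M n).critIndex b n)) atTop (𝓝 0)
  crit_tendsto : Tendsto (fun n : ℕ => ((M n).critIndex b n : ℝ) / n) atTop (𝓝 0)
  rank_tendsto :
    Tendsto (fun n : ℕ => (n : ℝ) / (M n).effRank' ((M n).critIndex b n)) atTop (𝓝 0)

namespace RegressionModel

variable {σx : ℝ} (M : RegressionModel σx)

/-- The right-hand side of the upper bound on the standard risk; `S` is `λ_{k+1} r_k`. -/
def riskBound (n k : ℕ) (lam : ℝ) : ℝ :=
  let S := M.ev k * M.effRank k
  M.tailNormSq k + (S ^ 2 + (n : ℝ) ^ 2 * lam ^ 2) / (n : ℝ) ^ 2 * M.headNormSq k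
    + M.noiseVar * ((k : ℝ) / n + n * (∑ j ∈ M.tail k, M.eigval j ^ 2) / (S + n * lam) ^ 2)

/-- The right-hand side of the lower bound on the squared norm; `S` is `λ_{k+1} r_k`. -/
def normBound (n k : ℕ) (lam : ℝ) : ℝ :=
  let S := M.ev k * M.effRank k
  (∑ j ∈ M.head k, (M.noiseVar / M.eigval j + n * M.coef j ^ 2) *
      min (1 / (n : ℝ)) (n * M.eigval j ^ 2 / (S + n * lam) ^ 2))
    + (n * M.noiseVar * S + (n : ℝ) ^ 2 * ∑ j ∈ M.tail k, M.coef j ^ 2 * M.eigval j ^ 2) /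
        (S ^ 2 + (n : ℝ) ^ 2 * lam ^ 2)

end RegressionModel

end

/-! ### Exponential moments of squares of subgaussian variables -/

section SubgaussianSquare

variable {Ω : Type*} [MeasurableSpace Ω] {μ : Measure Ω} {X : Ω → ℝ} {c : NNReal}

/-! In the eigenbasis the design becomes normalized feature columns `z_j` in `ℝⁿ` with independent
subgaussian entries, and `X Xᵀ + nλ = ∑ λ_j z_j z_jᵀ + μ` with `μ = nλ`. Split the indices at `k =
k*` and put `S = ∑_{j > k} λ_j = λ_{k+1} r_k`. Since `r_k ≥ n`, every tail eigenvalue is at most `S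
/ n`; since moreover `n / R_k` is small, the tail part of the Gram operator has its spectrum between
constant multiples of `S`. It acts like extra ridge regularization, so that tail plus `μ` is
comparable to the scalar `S + μ`. Since `k / n` is small, the head columns, even with one further
column adjoined, have a Gram matrix of order at least `n`. Both facts come from Chernoff bounds on a
net of the sphere (`IsSubgaussianArray.measure_not_quadratic_bounds_le_exp`).

The dimension `p` is not bounded in terms of `n`, so no union bound over the tail columns is
possible. Only weighted averages over the tail are controlled: the lengths of the columns by
Jensen's inequality for the exponential, and the total weight of the badly placed columns by
Markov's inequality. These properties make up `IsGoodDesign`, which fails with probability at most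
`14 exp (-a n)` (`RegressionModel.measure_compl_goodSet_le`). They do not mention `λ`, so one event
serves all `λ ≥ 0`.

The rest is deterministic. Let `q_j` solve `(X Xᵀ + nλ) q_j = z_j`. The `j`-th coordinate of the
ridge estimator is `√λ_j ⟪q_j, y⟫`, and averaging over noise and signs leaves exact quadratic
expressions in the `q_j` (`stdRisk_ridge_eq`, `sqNorm_ridge_eq`). With `D` denoting tail plus `μ`,
the energy `⟪q, D q⟫` is bounded through the equation for `q_j` and the conditioning of the head;
this gives the risk bound (`IsGoodDesign.risk_le`). For the norm, only the diagonal terms `⟪z_j,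
q_j⟫` are kept and bounded from below (`IsGoodDesign.le_norm`). -/

theorem lintegral_exp_mul_sq_gaussianReal_le {a : ℝ} (ha : 0 ≤ a) (ha' : 4 * a ≤ 1) :
    ∫⁻ x, ENNReal.ofReal (Real.exp (a * x ^ 2)) ∂(gaussianReal 0 1)
      ≤ ENNReal.ofReal (Real.exp (2 * a)) := by
  have hb : 0 < 1 / 2 - a := by linarith
  rw [gaussianReal_of_var_ne_zero _ one_ne_zero,
    lintegral_withDensity_eq_lintegral_mul _ (measurable_gaussianPDF 0 1) (by fun_prop)]
  have hpt : ∀ x : ℝ, (gaussianPDF 0 1 * fun x => ENNReal.ofReal (Real.exp (a * x ^ 2))) x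
      = ENNReal.ofReal ((√(2 * Real.pi))⁻¹ * Real.exp (-(1 / 2 - a) * x ^ 2)) := by
    intro x
    simp only [Pi.mul_apply, gaussianPDF, gaussianPDFReal]
    rw [← ENNReal.ofReal_mul (by positivity), mul_assoc, ← Real.exp_add]
    congr 2
    · simp
    · congr 1; simp; ring
  simp_rw [hpt]
  rw [← ofReal_integral_eq_lintegral_ofReal ((integrable_exp_neg_mul_sq hb).const_mul _)
    (ae_of_all _ fun x => by positivity), integral_const_mul, integral_gaussian]
  apply ENNReal.ofReal_le_ofReal
  rw [inv_mul_le_iff₀ (by positivity)]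
  rw [Real.sqrt_le_left (by positivity), mul_pow, Real.sq_sqrt (by positivity), ← Real.exp_nat_mul,
    div_le_iff₀ hb]
  -- The Gaussian integral equals `(1 - 2a)^(-1/2)`, so the claim is `1 ≤ (1 - 2a) e^{4a}`; the
  -- quadratic lower bound for `e^{4a}` suffices when `a ≤ 1/4`.
  have h1 : (1 - 2 * a) * Real.exp (((2 : ℕ) : ℝ) * (2 * a)) ≥ 1 := by
    have h2 : 1 + 4 * a + (4 * a) ^ 2 / 2 ≤ Real.exp (4 * a) :=
      Real.quadratic_le_exp_of_nonneg (by linarith)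
    have h3 : ((2 : ℕ) : ℝ) * (2 * a) = 4 * a := by push_cast; ring
    rw [h3]
    nlinarith
  generalize Real.exp (((2 : ℕ) : ℝ) * (2 * a)) = e at h1 ⊢
  nlinarith [mul_le_mul_of_nonneg_left h1 Real.pi_pos.le]

/-- Linearization by an auxiliary Gaussian: `exp (s x²) = E_g exp (√(2s) x g)`. After exchanging the
integrals, the subgaussian bound at fixed `g` reduces the claim to the Gaussian case with `a = c s`.
-/
theorem ProbabilityTheory.HasSubgaussianMGF.lintegral_exp_mul_sq_le [IsProbabilityMeasure μ]
    (h : HasSubgaussianMGF X c μ) (hX : Measurable X) {s : ℝ} (hs : 0 ≤ s) (hcs : 4 * c * s ≤ 1) :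
    ∫⁻ ω, ENNReal.ofReal (Real.exp (s * X ω ^ 2)) ∂μ ≤ ENNReal.ofReal (Real.exp (2 * c * s)) := by
  have hg : ∀ x : ℝ, ENNReal.ofReal (Real.exp (s * x ^ 2))
      = ∫⁻ g, ENNReal.ofReal (Real.exp (√(2 * s) * x * g)) ∂(gaussianReal 0 1) := by
    intro x
    rw [← ofReal_integral_eq_lintegral_ofReal (integrable_exp_mul_gaussianReal _)
      (ae_of_all _ fun g => by positivity)]
    have := congrFun (mgf_id_gaussianReal (μ := 0) (v := 1)) (√(2 * s) * x)
    simp only [mgf, id] at this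
    rw [this]
    congr 2
    rw [mul_pow, Real.sq_sqrt (by positivity)]
    push_cast; ring
  simp_rw [hg]
  rw [lintegral_lintegral_swap (by fun_prop)]
  calc ∫⁻ g, ∫⁻ ω, ENNReal.ofReal (Real.exp (√(2 * s) * X ω * g)) ∂μ ∂(gaussianReal 0 1)
      ≤ ∫⁻ g, ENNReal.ofReal (Real.exp (c * s * g ^ 2)) ∂(gaussianReal 0 1) := by
        apply lintegral_mono
        intro g
        have h1 := h.mgf_le (√(2 * s) * g)
        have h2 := h.integrable_exp_mul (√(2 * s) * g)
        simp only [mgf] at h1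
        have h3 : ∀ ω, √(2 * s) * X ω * g = √(2 * s) * g * X ω := fun ω => by ring
        simp_rw [h3]
        rw [← ofReal_integral_eq_lintegral_ofReal h2 (ae_of_all _ fun g => by positivity)]
        apply ENNReal.ofReal_le_ofReal
        refine h1.trans (le_of_eq ?_)
        rw [mul_pow, Real.sq_sqrt (by positivity)]
        congr 1; ring
    _ ≤ _ := by
        refine (lintegral_exp_mul_sq_gaussianReal_le (by positivity) (by linarith)).trans
          (le_of_eq ?_)
        congr 2; ring

theorem pow_four_le_exp_add_exp (x : ℝ) : x ^ 4 ≤ 24 * (Real.exp x + Real.exp (-x)) := by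
  have h : ∀ y : ℝ, 0 ≤ y → y ^ 4 ≤ 24 * Real.exp y := fun y hy => by
    have := Real.pow_div_factorial_le_exp y hy 4
    rw [div_le_iff₀ (by positivity)] at this
    norm_num [Nat.factorial] at this
    linarith
  rcases le_total 0 x with hx | hx
  · linarith [h x hx, Real.exp_pos (-x)]
  · have := h (-x) (by linarith)
    have h4 : (-x) ^ 4 = x ^ 4 := by ring
    linarith [Real.exp_pos x]

theorem ProbabilityTheory.HasSubgaussianMGF.integral_pow_four_le [IsProbabilityMeasure μ]
    (h : HasSubgaussianMGF X c μ) (hc : 0 < c) :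
    Integrable (fun ω => X ω ^ 4) μ ∧ ∫ ω, X ω ^ 4 ∂μ ≤ 80 * (c : ℝ) ^ 2 := by
  have hint : Integrable (fun ω => X ω ^ 4) μ := by
    have := (h.memLp 4).integrable_norm_pow (by norm_num)
    refine this.congr (ae_of_all _ fun ω => ?_)
    simp [Even.pow_abs (⟨2, rfl⟩ : Even 4)]
  refine ⟨hint, ?_⟩
  have hc' : (0 : ℝ) < c := hc
  set t : ℝ := 1 / √c
  have ht2 : t ^ 2 = 1 / c := by simp [t, Real.sq_sqrt hc'.le]
  -- The scaling `t = 1/√c` bounds both exponential moments by `e^{1/2} ≤ 5/3`, and `24 · 2 · 5/3 =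
  -- 80`.
  have ht4 : t ^ 4 = 1 / (c : ℝ) ^ 2 := by
    rw [show t ^ 4 = (t ^ 2) ^ 2 by ring, ht2]; simp
  have hb : ∀ r : ℝ, r ^ 2 = t ^ 2 → ∫ ω, Real.exp (r * X ω) ∂μ ≤ Real.exp (1 / 2) := by
    intro r hr
    refine (h.mgf_le r).trans (le_of_eq ?_)
    rw [hr, ht2]; congr 1; field_simp
  have h1 := hb t rfl
  have h2 := hb (-t) (by ring)
  have hexp : Real.exp (1 / 2) ≤ 5 / 3 := by
    have hsq : Real.exp (1 / 2) * Real.exp (1 / 2) = Real.exp 1 := by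
      rw [← Real.exp_add]; norm_num
    have := Real.exp_one_lt_d9
    nlinarith [Real.exp_pos (1 / 2)]
  have hle : ∫ ω, t ^ 4 * X ω ^ 4 ∂μ
      ≤ ∫ ω, 24 * (Real.exp (t * X ω) + Real.exp (-t * X ω)) ∂μ := by
    apply integral_mono (hint.const_mul _)
      (((h.integrable_exp_mul t).add (h.integrable_exp_mul (-t))).const_mul _)
    intro ω
    have := pow_four_le_exp_add_exp (t * X ω)
    simp only [mul_pow, neg_mul] at this ⊢
    exact this
  rw [integral_const_mul, integral_const_mul,
    integral_add (h.integrable_exp_mul t) (h.integrable_exp_mul (-t)), ht4] at hle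
  have h3 : 1 / (c : ℝ) ^ 2 * ∫ ω, X ω ^ 4 ∂μ ≤ 80 := by linarith
  rw [one_div, inv_mul_le_iff₀ (by positivity)] at h3
  linarith

/-- For `y ≥ 0` one has `e^{-y} ≤ 1 - y + y²/2`. Integrating at `y = s X²` uses only the unit
variance and the fourth moment, whence `40 = 80/2`. -/
theorem ProbabilityTheory.HasSubgaussianMGF.lintegral_exp_neg_mul_sq_le [IsProbabilityMeasure μ]
    (h : HasSubgaussianMGF X c μ) (hc : 0 < c) (hvar : ∫ ω, X ω ^ 2 ∂μ = 1)
    {s : ℝ} (hs : 0 ≤ s) :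
    ∫⁻ ω, ENNReal.ofReal (Real.exp (-s * X ω ^ 2)) ∂μ
      ≤ ENNReal.ofReal (Real.exp (-s + 40 * c ^ 2 * s ^ 2)) := by
  obtain ⟨h4, h4'⟩ := h.integral_pow_four_le hc
  have h2 : Integrable (fun ω => X ω ^ 2) μ := (h.memLp 2).integrable_sq
  have hle : ∀ ω, Real.exp (-s * X ω ^ 2) ≤ 1 - s * X ω ^ 2 + s ^ 2 / 2 * X ω ^ 4 := by
    intro ω
    have hy : 0 ≤ s * X ω ^ 2 := by positivity
    have h1 := Real.quadratic_le_exp_of_nonneg hy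
    have h5 : Real.exp (-s * X ω ^ 2) * Real.exp (s * X ω ^ 2) = 1 := by
      rw [← Real.exp_add]; simp
    have h6 := Real.exp_pos (-s * X ω ^ 2)
    have h7 : s ^ 2 / 2 * X ω ^ 4 = (s * X ω ^ 2) ^ 2 / 2 := by ring
    rw [h7]
    set y := s * X ω ^ 2
    set e := Real.exp (-s * X ω ^ 2)
    have h8 : e * (1 + y + y ^ 2 / 2) ≤ 1 := by nlinarith
    -- The product on the right is `1 + y⁴/4`.
    have h9 : 1 ≤ (1 - y + y ^ 2 / 2) * (1 + y + y ^ 2 / 2) := by nlinarith [sq_nonneg (y ^ 2)]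
    have h10 : 0 < 1 + y + y ^ 2 / 2 := by positivity
    nlinarith
  have h3 : Integrable (fun ω => 1 - s * X ω ^ 2) μ := (integrable_const 1).sub (h2.const_mul s)
  have hi : Integrable (fun ω => 1 - s * X ω ^ 2 + s ^ 2 / 2 * X ω ^ 4) μ :=
    h3.add (h4.const_mul _)
  calc ∫⁻ ω, ENNReal.ofReal (Real.exp (-s * X ω ^ 2)) ∂μ
      ≤ ∫⁻ ω, ENNReal.ofReal (1 - s * X ω ^ 2 + s ^ 2 / 2 * X ω ^ 4) ∂μ :=
        lintegral_mono fun ω => ENNReal.ofReal_le_ofReal (hle ω)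
    _ = ENNReal.ofReal (∫ ω, (1 - s * X ω ^ 2 + s ^ 2 / 2 * X ω ^ 4) ∂μ) :=
        (ofReal_integral_eq_lintegral_ofReal hi
          (ae_of_all _ fun ω => (Real.exp_pos _).le.trans (hle ω))).symm
    _ ≤ _ := by
        apply ENNReal.ofReal_le_ofReal
        rw [integral_add h3 (h4.const_mul _),
          integral_sub (integrable_const 1) (h2.const_mul s), integral_const_mul,
          integral_const_mul, hvar]
        simp only [integral_const, probReal_univ, smul_eq_mul, mul_one]
        have := Real.add_one_le_exp (-s + 40 * c ^ 2 * s ^ 2)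
        nlinarith [sq_nonneg s]

end SubgaussianSquare

/-! ### Tails of weighted sums of squares of independent subgaussian variables -/

section WeightedSumSquares

variable {Ω : Type*} [MeasurableSpace Ω] {μ : Measure Ω}

theorem measure_ge_le_exp_mul_lintegral_exp {Y : Ω → ℝ} (hY : Measurable Y) (a : ℝ) :
    μ {ω | a ≤ Y ω} ≤ ENNReal.ofReal (Real.exp (-a)) * ∫⁻ ω, ENNReal.ofReal (Real.exp (Y ω)) ∂μ := by
  have h := mul_meas_ge_le_lintegral (μ := μ) (f := fun ω => ENNReal.ofReal (Real.exp (Y ω)))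
    (by fun_prop) (ENNReal.ofReal (Real.exp a))
  have hset : {ω | ENNReal.ofReal (Real.exp a) ≤ ENNReal.ofReal (Real.exp (Y ω))}
      = {ω | a ≤ Y ω} := by
    ext ω
    simp [ENNReal.ofReal_le_ofReal_iff (Real.exp_pos _).le]
  rw [hset] at h
  calc μ {ω | a ≤ Y ω}
      = ENNReal.ofReal (Real.exp (-a)) * (ENNReal.ofReal (Real.exp a) * μ {ω | a ≤ Y ω}) := by
        rw [← mul_assoc, ← ENNReal.ofReal_mul (by positivity), ← Real.exp_add]
        simp
    _ ≤ _ := by gcongr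

variable {J : Type*} [Fintype J] {ζ : J → Ω → ℝ} {c : NNReal}

theorem ProbabilityTheory.iIndepFun.lintegral_exp_sum_sq (hind : iIndepFun ζ μ)
    (hm : ∀ j, Measurable (ζ j)) (a : J → ℝ) :
    ∫⁻ ω, ENNReal.ofReal (Real.exp (∑ j, a j * ζ j ω ^ 2)) ∂μ
      = ∏ j, ∫⁻ ω, ENNReal.ofReal (Real.exp (a j * ζ j ω ^ 2)) ∂μ := by
  rw [← lintegral_prod_eq_prod_lintegral_of_indepFun Finset.univ
    (fun j ω => ENNReal.ofReal (Real.exp (a j * ζ j ω ^ 2)))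
    (hind.comp (fun j x => ENNReal.ofReal (Real.exp (a j * x ^ 2))) (by fun_prop)) (by fun_prop)]
  refine lintegral_congr fun ω => ?_
  rw [Real.exp_sum, ENNReal.ofReal_prod_of_nonneg fun j _ => (Real.exp_pos _).le]

theorem prod_ofReal_exp_le {f : J → ENNReal} {a : J → ℝ}
    (h : ∀ j, f j ≤ ENNReal.ofReal (Real.exp (a j))) :
    ∏ j, f j ≤ ENNReal.ofReal (Real.exp (∑ j, a j)) := by
  rw [Real.exp_sum, ENNReal.ofReal_prod_of_nonneg fun j _ => (Real.exp_pos _).le]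
  exact Finset.prod_le_prod' fun j _ => h j

/-- Chernoff's bound at `t = 1/(4 c m)`, the largest value for which the square-exponential bound
applies to every weight. -/
theorem measure_weighted_sum_sq_ge_le [IsProbabilityMeasure μ] (hind : iIndepFun ζ μ)
    (hm : ∀ j, Measurable (ζ j)) (hs : ∀ j, HasSubgaussianMGF (ζ j) c μ) (hc : 0 < c)
    {w : J → ℝ} (hw : ∀ j, 0 ≤ w j) {m : ℝ} (hm0 : 0 < m) (hwm : ∀ j, w j ≤ m) (C : ℝ) :
    μ {ω | C * ∑ j, w j ≤ ∑ j, w j * ζ j ω ^ 2}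
      ≤ ENNReal.ofReal (Real.exp (-((C - 2 * c) * (∑ j, w j) / (4 * c * m)))) := by
  have hc' : (0 : ℝ) < c := hc
  set t : ℝ := 1 / (4 * c * m)
  have ht : 0 < t := by positivity
  have h1 : {ω | C * ∑ j, w j ≤ ∑ j, w j * ζ j ω ^ 2}
      = {ω | t * (C * ∑ j, w j) ≤ ∑ j, (t * w j) * ζ j ω ^ 2} := by
    ext ω
    simp only [Set.mem_ofPred_eq, mul_assoc, ← Finset.mul_sum]
    exact (mul_le_mul_iff_right₀ ht).symm
  rw [h1]
  refine (measure_ge_le_exp_mul_lintegral_exp (by fun_prop) _).trans ?_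
  rw [hind.lintegral_exp_sum_sq hm]
  have h2 : ∀ j, ∫⁻ ω, ENNReal.ofReal (Real.exp (t * w j * ζ j ω ^ 2)) ∂μ
      ≤ ENNReal.ofReal (Real.exp (2 * c * (t * w j))) := fun j => by
    refine (hs j).lintegral_exp_mul_sq_le (hm j) (mul_nonneg ht.le (hw j)) ?_
    have : 4 * c * (t * w j) = w j / m := by simp only [t]; field_simp
    rw [this, div_le_one hm0]
    exact hwm j
  refine (mul_le_mul_right (prod_ofReal_exp_le h2) _).trans ?_
  rw [← ENNReal.ofReal_mul (by positivity), ← Real.exp_add]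
  apply le_of_eq
  congr 2
  rw [← Finset.mul_sum, ← Finset.mul_sum]
  simp only [t]; ring

theorem measure_weighted_sum_sq_le_half_le [IsProbabilityMeasure μ] (hind : iIndepFun ζ μ)
    (hm : ∀ j, Measurable (ζ j)) (hs : ∀ j, HasSubgaussianMGF (ζ j) c μ) (hc : 0 < c)
    (hvar : ∀ j, ∫ ω, ζ j ω ^ 2 ∂μ = 1)
    {w : J → ℝ} (hw : ∀ j, 0 ≤ w j) (hV : 0 < ∑ j, w j ^ 2) :
    μ {ω | ∑ j, w j * ζ j ω ^ 2 ≤ (∑ j, w j) / 2}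
      ≤ ENNReal.ofReal (Real.exp (-((∑ j, w j) ^ 2 / (640 * c ^ 2 * ∑ j, w j ^ 2)))) := by
  have hc' : (0 : ℝ) < c := hc
  set W := ∑ j, w j with hW
  set V := ∑ j, w j ^ 2 with hVdef
  have hW0 : 0 < W := by
    refine lt_of_le_of_ne (Finset.sum_nonneg fun j _ => hw j) fun h0 => ?_
    have : ∀ j ∈ Finset.univ, w j = 0 :=
      (Finset.sum_eq_zero_iff_of_nonneg fun j _ => hw j).1 h0.symm
    have h0' : V = 0 := Finset.sum_eq_zero fun j hj => by simp [this j hj]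
    exact hV.ne' h0'
  -- This `t` minimizes the Chernoff exponent `-tW/2 + 40 c² t² V`; the minimum is `-W²/(640 c² V)`.
  set t : ℝ := W / (160 * c ^ 2 * V) with ht_def
  have ht : 0 < t := by positivity
  have h1 : {ω | ∑ j, w j * ζ j ω ^ 2 ≤ W / 2}
      = {ω | -(t * (W / 2)) ≤ ∑ j, (-(t * w j)) * ζ j ω ^ 2} := by
    ext ω
    simp only [Set.mem_ofPred_eq, neg_mul, Finset.sum_neg_distrib, mul_assoc, ← Finset.mul_sum,
      neg_le_neg_iff]
    exact (mul_le_mul_iff_right₀ ht).symm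
  rw [h1]
  refine (measure_ge_le_exp_mul_lintegral_exp (by fun_prop) _).trans ?_
  rw [hind.lintegral_exp_sum_sq hm]
  have h2 : ∀ j, ∫⁻ ω, ENNReal.ofReal (Real.exp (-(t * w j) * ζ j ω ^ 2)) ∂μ
      ≤ ENNReal.ofReal (Real.exp (-(t * w j) + 40 * c ^ 2 * (t * w j) ^ 2)) := fun j =>
    (hs j).lintegral_exp_neg_mul_sq_le hc (hvar j) (mul_nonneg ht.le (hw j))
  refine (mul_le_mul_right (prod_ofReal_exp_le h2) _).trans ?_
  rw [← ENNReal.ofReal_mul (by positivity), ← Real.exp_add]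
  apply le_of_eq
  congr 2
  rw [Finset.sum_add_distrib, Finset.sum_neg_distrib, ← Finset.mul_sum, ← Finset.mul_sum]
  simp only [mul_pow]
  rw [← Finset.mul_sum, ← hW, ← hVdef, ht_def]
  field_simp
  ring

end WeightedSumSquares

/-! ### Nets of the unit sphere -/

section Net

open Module Metric

variable {E : Type*} [NormedAddCommGroup E] [NormedSpace ℝ E]

-- Volume comparison: the balls of radius `ε/2` about the points are disjoint and lie in the ball of
-- radius `1 + ε/2`.
open scoped Function in
theorem card_le_of_separated_of_norm_eq_one [FiniteDimensional ℝ E] {ε : ℝ} (hε : 0 < ε) (s : Finset E)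
    (hs : ∀ x ∈ s, ‖x‖ = 1) (h : ∀ x ∈ s, ∀ y ∈ s, x ≠ y → ε ≤ ‖x - y‖) :
    (s.card : ℝ) ≤ (1 + 2 / ε) ^ finrank ℝ E := by
  borelize E
  let μ : Measure E := Measure.addHaar
  set δ : ℝ := ε / 2
  set ρ : ℝ := 1 + ε / 2
  have hδ : 0 < δ := by positivity
  have hρ : 0 < ρ := by positivity
  have D : Set.Pairwise (s : Set E) (Disjoint on fun c => ball (c : E) δ) := by
    rintro x hx y hy hxy
    apply ball_disjoint_ball
    rw [dist_eq_norm]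
    simpa [δ] using h x hx y hy hxy
  have hsub : (⋃ x ∈ s, ball (x : E) δ) ⊆ ball (0 : E) ρ := by
    refine Set.iUnion₂_subset fun x hx => ball_subset_ball' ?_
    rw [dist_zero_right, hs x hx, add_comm]
  have I : (s.card : ENNReal) * ENNReal.ofReal (δ ^ finrank ℝ E) * μ (ball 0 1) ≤
      ENNReal.ofReal (ρ ^ finrank ℝ E) * μ (ball 0 1) :=
    calc (s.card : ENNReal) * ENNReal.ofReal (δ ^ finrank ℝ E) * μ (ball 0 1)
        = μ (⋃ x ∈ s, ball (x : E) δ) := by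
          rw [measure_biUnion_finset D fun c _ => measurableSet_ball]
          simp only [μ.addHaar_ball_of_pos _ hδ]
          simp only [Finset.sum_const, nsmul_eq_mul, mul_assoc]
      _ ≤ μ (ball (0 : E) ρ) := measure_mono hsub
      _ = ENNReal.ofReal (ρ ^ finrank ℝ E) * μ (ball 0 1) := by
          simp only [μ.addHaar_ball_of_pos _ hρ]
  have K := (ENNReal.mul_le_mul_iff_left (measure_ball_pos _ _ zero_lt_one).ne'
    measure_ball_lt_top.ne).1 I
  have K' := ENNReal.toReal_le_of_le_ofReal (pow_nonneg hρ.le _) K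
  rw [ENNReal.toReal_mul, ENNReal.toReal_ofReal (by positivity), ENNReal.toReal_natCast,
    ← le_div_iff₀ (by positivity), ← div_pow] at K'
  refine K'.trans (le_of_eq ?_)
  congr 1
  simp only [ρ, δ]
  field_simp
  ring

-- A separated subset of the sphere of maximal cardinality is a net, since a point far from all of
-- it could be adjoined.
variable (E) in
theorem exists_sphere_net [FiniteDimensional ℝ E] {ε : ℝ} (hε : 0 < ε) :
    ∃ N : Finset E, (∀ x ∈ N, ‖x‖ = 1) ∧ (∀ x : E, ‖x‖ = 1 → ∃ y ∈ N, ‖x - y‖ ≤ ε) ∧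
      (N.card : ℝ) ≤ (1 + 2 / ε) ^ finrank ℝ E := by
  classical
  let P : Finset E → Prop := fun s =>
    (∀ x ∈ s, ‖x‖ = 1) ∧ ∀ x ∈ s, ∀ y ∈ s, x ≠ y → ε ≤ ‖x - y‖
  have hbdd : BddAbove {k : ℕ | ∃ s, P s ∧ s.card = k} := by
    refine ⟨⌊(1 + 2 / ε) ^ finrank ℝ E⌋₊, ?_⟩
    rintro _ ⟨s, hs, rfl⟩
    exact Nat.le_floor (card_le_of_separated_of_norm_eq_one hε s hs.1 hs.2)
  obtain ⟨N, hN, hNmax⟩ := Nat.sSup_mem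
    (⟨0, ∅, by simp [P], rfl⟩ : {k : ℕ | ∃ s, P s ∧ s.card = k}.Nonempty) hbdd
  refine ⟨N, hN.1, fun x hx => ?_, card_le_of_separated_of_norm_eq_one hε N hN.1 hN.2⟩
  by_contra! hfar
  have hxN : x ∉ N := fun hmem => by
    have := hfar x hmem
    simp only [sub_self, norm_zero] at this
    linarith
  have hP : P (insert x N) := by
    refine ⟨fun y hy => ?_, fun y hy z hz hyz => ?_⟩
    · rcases Finset.mem_insert.1 hy with rfl | hy
      exacts [hx, hN.1 y hy]
    · rcases Finset.mem_insert.1 hy with h1 | hy' <;> rcases Finset.mem_insert.1 hz with h2 | hz'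
      · exact absurd (h1.trans h2.symm) hyz
      · rw [h1]; exact (hfar z hz').le
      · rw [h2, norm_sub_rev]; exact (hfar y hy').le
      · exact hN.2 y hy' z hz' hyz
  have := le_csSup hbdd ⟨insert x N, hP, rfl⟩
  rw [← hNmax, Finset.card_insert_of_notMem hxN] at this
  omega

/-- A seminorm that is at most `A` on a `1/2`-net of the unit sphere is at most `2 A` on it. -/
theorem Seminorm.le_of_sphere_net [FiniteDimensional ℝ E] (q : Seminorm ℝ E) {N : Finset E}
    (hN : ∀ x : E, ‖x‖ = 1 → ∃ y ∈ N, ‖x - y‖ ≤ 1 / 2) {A : ℝ} (hA : ∀ y ∈ N, q y ≤ A)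
    (x : E) : q x ≤ 2 * A * ‖x‖ := by
  have hcont : Continuous q := by
    have : ContinuousOn q Set.univ :=
      (q.convexOn.continuousOn isOpen_univ)
    exact continuousOn_univ.1 this
  rcases subsingleton_or_nontrivial E with hE | hE
  · simp [Subsingleton.elim x 0]
  -- At a maximizer `x₀` with net point `y`, `q x₀ ≤ q (x₀ - y) + q y ≤ q x₀ / 2 + A`, and the first
  -- term is absorbed.
  obtain ⟨x₀, hx₀, hmax⟩ := (isCompact_sphere (0 : E) 1).exists_isMaxOn
    (NormedSpace.sphere_nonempty.2 zero_le_one) hcont.continuousOn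
  have hx₀' : ‖x₀‖ = 1 := by simpa using hx₀
  have hle : ∀ y : E, q y ≤ q x₀ * ‖y‖ := by
    intro y
    rcases eq_or_ne y 0 with rfl | hy
    · simp
    have hy' : 0 < ‖y‖ := norm_pos_iff.2 hy
    have h1 : q (‖y‖⁻¹ • y) ≤ q x₀ := hmax (by simp [norm_smul, hy'.ne'])
    rw [map_smul_eq_mul] at h1
    simp only [norm_inv, norm_norm] at h1
    rwa [inv_mul_le_iff₀ hy', mul_comm] at h1
  obtain ⟨y, hy, hxy⟩ := hN x₀ hx₀'
  have h2 : q x₀ ≤ q (x₀ - y) + q y := by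
    have := map_add_le_add q (x₀ - y) y
    simpa using this
  have h3 := hle (x₀ - y)
  have h4 : q x₀ * ‖x₀ - y‖ ≤ q x₀ * (1 / 2) :=
    mul_le_mul_of_nonneg_left hxy (apply_nonneg q x₀)
  have h5 := hA y hy
  have h6 : q x₀ ≤ 2 * A := by linarith
  exact (hle x).trans (mul_le_mul_of_nonneg_right h6 (norm_nonneg x))

/-- A seminorm bounded by `A` times the norm that is at least `B` on an `ε`-net of the unit sphere
is at least `B - ε A` on it. -/
theorem Seminorm.ge_of_sphere_net (q : Seminorm ℝ E) {N : Finset E} {ε : ℝ}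
    (hN : ∀ x : E, ‖x‖ = 1 → ∃ y ∈ N, ‖x - y‖ ≤ ε) {A B : ℝ} (hA0 : 0 ≤ A)
    (hA : ∀ y, q y ≤ A * ‖y‖) (hB : ∀ y ∈ N, B ≤ q y) (x : E) : (B - ε * A) * ‖x‖ ≤ q x := by
  rcases eq_or_ne x 0 with rfl | hx
  · simp
  have hx' : 0 < ‖x‖ := norm_pos_iff.2 hx
  obtain ⟨y, hy, hxy⟩ := hN (‖x‖⁻¹ • x) (by simp [norm_smul, hx'.ne'])
  have h1 : q y ≤ q (y - ‖x‖⁻¹ • x) + q (‖x‖⁻¹ • x) := by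
    have := map_add_le_add q (y - ‖x‖⁻¹ • x) (‖x‖⁻¹ • x)
    simpa using this
  have h2 := hA (y - ‖x‖⁻¹ • x)
  rw [norm_sub_rev] at h2
  have h3 : A * ‖‖x‖⁻¹ • x - y‖ ≤ A * ε := mul_le_mul_of_nonneg_left hxy hA0
  have h4 := hB y hy
  rw [map_smul_eq_mul] at h1
  simp only [norm_inv, norm_norm] at h1
  have h5 : B - ε * A ≤ ‖x‖⁻¹ * q x := by linarith
  rwa [← div_eq_inv_mul, le_div_iff₀ hx'] at h5

end Net

/-! ### Random matrices with independent subgaussian entries -/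

section SubgaussianArray

variable {Ω : Type*} [MeasurableSpace Ω] {μ : Measure Ω} {I J : Type*}

theorem ProbabilityTheory.iIndepFun.integral_sum_mul_sq [IsProbabilityMeasure μ] [Fintype J] {ζ : J → Ω → ℝ}
    (hind : iIndepFun ζ μ) (hL : ∀ j, MemLp (ζ j) 2 μ) (hmean : ∀ j, ∫ ω, ζ j ω ∂μ = 0)
    (hvar : ∀ j, ∫ ω, ζ j ω ^ 2 ∂μ = 1) (a : J → ℝ) :
    ∫ ω, (∑ j, a j * ζ j ω) ^ 2 ∂μ = ∑ j, a j ^ 2 := by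
  have hi : iIndepFun (fun j ω => a j * ζ j ω) μ :=
    hind.comp (fun j x => a j * x) fun _ => by fun_prop
  have hL' : ∀ j, MemLp (fun ω => a j * ζ j ω) 2 μ := fun j => (hL j).const_mul (a j)
  have hmean' : ∫ ω, ∑ j, a j * ζ j ω ∂μ = 0 := by
    rw [integral_finsetSum _ fun j _ => (hL' j).integrable (by norm_num)]
    simp [integral_const_mul, hmean]
  have hv := IndepFun.variance_sum (s := Finset.univ) (fun j _ => hL' j)
    (fun i _ k _ hik => hi.indepFun hik)
  have hv2 : ∀ j, Var[fun ω => a j * ζ j ω; μ] = a j ^ 2 := fun j => by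
    rw [variance_const_mul, variance_of_integral_eq_zero (hL j).aestronglyMeasurable.aemeasurable
      (hmean j), hvar, mul_one]
  simp only [hv2] at hv
  rw [← hv, variance_of_integral_eq_zero]
  · simp
  · exact (memLp_finsetSum' _ fun j _ => hL' j).aestronglyMeasurable.aemeasurable
  · simpa using hmean'

/-- The entries of the random matrix `g` are independent, centred, of unit variance, and
subgaussian with variance proxy `c`. -/
structure IsSubgaussianArray (g : I → J → Ω → ℝ) (c : NNReal) (μ : Measure Ω) : Prop where
  measurable : ∀ i j, Measurable (g i j)
  indep : iIndepFun (fun (q : I × J) ω => g q.1 q.2 ω) μ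
  subgaussian : ∀ i j, HasSubgaussianMGF (g i j) c μ
  mean_zero : ∀ i j, ∫ ω, g i j ω ∂μ = 0
  unit_var : ∀ i j, ∫ ω, g i j ω ^ 2 ∂μ = 1

/-- Independence of all entries makes the joint law a product over `I × J`; currying turns it into a
product over `I` of the row laws. -/
theorem ProbabilityTheory.iIndepFun.pi_of_prod [IsProbabilityMeasure μ] {g : I → J → Ω → ℝ}
    (hm : ∀ i j, Measurable (g i j)) (h : iIndepFun (fun (q : I × J) ω => g q.1 q.2 ω) μ) :
    iIndepFun (fun i ω j => g i j ω) μ := by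
  have hp : ∀ i j, IsProbabilityMeasure (μ.map (g i j)) :=
    fun i j => Measure.isProbabilityMeasure_map (hm i j).aemeasurable
  have hs : iIndepFun (fun (q : (_ : I) × J) ω => g q.1 q.2 ω) μ :=
    h.precomp (g := fun q : (_ : I) × J => (q.1, q.2)) (Equiv.sigmaEquivProd I J).injective
  rw [iIndepFun_iff_map_fun_eq_infinitePi_map (fun q => hm _ _)] at hs
  rw [iIndepFun_iff_map_fun_eq_infinitePi_map (fun i => measurable_pi_iff.2 fun j => hm i j)]
  have hc := congrArg (Measure.map (MeasurableEquiv.piCurry fun (_ : I) (_ : J) => ℝ)) hs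
  rw [Measure.infinitePi_map_piCurry (fun i j => μ.map (g i j)),
    Measure.map_map (by fun_prop) (measurable_pi_iff.2 fun q => hm _ _)] at hc
  have he : (MeasurableEquiv.piCurry fun (_ : I) (_ : J) => ℝ) ∘
      (fun ω (q : (_ : I) × J) => g q.1 q.2 ω) = fun ω i j => g i j ω := by
    ext; simp [Sigma.curry]
  rw [he] at hc
  rw [hc]
  congr 1
  funext i
  have h3 := h.precomp (g := fun j : J => (i, j)) (Prod.mk_right_injective i)
  exact ((iIndepFun_iff_map_fun_eq_infinitePi_map (fun j => hm i j)).1 h3).symm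

namespace IsSubgaussianArray

variable {g : I → J → Ω → ℝ} {c : NNReal}

theorem swap (h : IsSubgaussianArray g c μ) : IsSubgaussianArray (fun j i => g i j) c μ where
  measurable j i := h.measurable i j
  indep := h.indep.precomp (g := fun q : J × I => (q.2, q.1)) Prod.swap_injective
  subgaussian j i := h.subgaussian i j
  mean_zero j i := h.mean_zero i j
  unit_var j i := h.unit_var i j

theorem comp {I' J' : Type*} (h : IsSubgaussianArray g c μ) {e : I' → I} {f : J' → J}
    (he : e.Injective) (hf : f.Injective) :
    IsSubgaussianArray (fun i j => g (e i) (f j)) c μ where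
  measurable _ _ := h.measurable _ _
  indep := h.indep.precomp (g := fun q : I' × J' => (e q.1, f q.2)) (he.prodMap hf)
  subgaussian _ _ := h.subgaussian _ _
  mean_zero _ _ := h.mean_zero _ _
  unit_var _ _ := h.unit_var _ _

theorem iIndepFun_combination [IsProbabilityMeasure μ] [Fintype I] (h : IsSubgaussianArray g c μ) (u : I → ℝ) :
    iIndepFun (fun j ω => ∑ i, u i * g i j ω) μ :=
  (iIndepFun.pi_of_prod h.swap.measurable h.swap.indep).comp
    (fun _ x => ∑ i, u i * x i) fun _ => by fun_prop

/-- The variance proxies `u_i² c` of the independent summands add up to `c`. -/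
theorem hasSubgaussianMGF_combination [Fintype I] (h : IsSubgaussianArray g c μ) {u : I → ℝ}
    (hu : ∑ i, u i ^ 2 = 1) (j : J) : HasSubgaussianMGF (fun ω => ∑ i, u i * g i j ω) c μ := by
  have hi : iIndepFun (fun i ω => u i * g i j ω) μ :=
    (h.indep.precomp (g := fun i : I => (i, j)) (Prod.mk_left_injective j)).comp
      (fun i x => u i * x) fun _ => by fun_prop
  have hsub : ∀ i, HasSubgaussianMGF (fun ω => u i * g i j ω) (Real.toNNReal (u i ^ 2) * c) μ := by
    intro i
    rw [Real.toNNReal_of_nonneg (sq_nonneg _)]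
    exact (h.subgaussian i j).const_mul (u i)
  have := HasSubgaussianMGF.sum_of_iIndepFun hi (s := Finset.univ) fun i _ => hsub i
  rwa [← Finset.sum_mul, ← Real.toNNReal_sum_of_nonneg fun i _ => sq_nonneg _, hu,
    Real.toNNReal_one, one_mul] at this

theorem integral_combination_sq [IsProbabilityMeasure μ] [Fintype I] (h : IsSubgaussianArray g c μ) {u : I → ℝ}
    (hu : ∑ i, u i ^ 2 = 1) (j : J) : ∫ ω, (∑ i, u i * g i j ω) ^ 2 ∂μ = 1 := by
  have hi : iIndepFun (fun i ω => g i j ω) μ :=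
    h.indep.precomp (g := fun i : I => (i, j)) (Prod.mk_left_injective j)
  rw [hi.integral_sum_mul_sq (fun i => (h.subgaussian i j).memLp 2) (fun i => h.mean_zero i j)
    (fun i => h.unit_var i j) u, hu]

end IsSubgaussianArray

variable [Fintype I] [Fintype J]

/-- The seminorm `u ↦ (∑ j, w j (∑ i, u i a i j)²)^(1/2)`. -/
noncomputable def weightedSeminorm (a : I → J → ℝ) (w : J → ℝ) : Seminorm ℝ (EuclideanSpace ℝ I) :=
  (normSeminorm ℝ (EuclideanSpace ℝ J)).comp
    ((WithLp.linearEquiv 2 ℝ (J → ℝ)).symm.toLinearMap ∘ₗ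
      (LinearMap.pi fun j => ∑ i, (√(w j) * a i j) • (LinearMap.proj i)) ∘ₗ
      (WithLp.linearEquiv 2 ℝ (I → ℝ)).toLinearMap)

theorem weightedSeminorm_sq {a : I → J → ℝ} {w : J → ℝ} (hw : ∀ j, 0 ≤ w j)
    (u : EuclideanSpace ℝ I) :
    weightedSeminorm a w u ^ 2 = ∑ j, w j * (∑ i, u i * a i j) ^ 2 := by
  simp only [weightedSeminorm, Seminorm.comp_apply, coe_normSeminorm]
  rw [EuclideanSpace.norm_sq_eq]
  refine Finset.sum_congr rfl fun j _ => ?_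
  have : ∀ i, √(w j) * a i j * u i = √(w j) * (u i * a i j) := fun i => by ring
  simp [this, ← Finset.mul_sum, mul_pow, Real.sq_sqrt (hw j)]

end SubgaussianArray

/-! ### Uniform bounds for random quadratic forms -/

section UniformBounds

variable {Ω : Type*} [MeasurableSpace Ω] {μ : Measure Ω}
  {I J : Type*} [Fintype I] {g : I → J → Ω → ℝ} {c : NNReal}

theorem measure_exists_mem_finset_le {α : Type*} (N : Finset α) (B : α → Set Ω) {e K : ℝ}
    (he : 0 ≤ e) (hB : ∀ x ∈ N, μ (B x) ≤ ENNReal.ofReal e) (hN : (N.card : ℝ) ≤ K) :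
    μ {ω | ∃ x ∈ N, ω ∈ B x} ≤ ENNReal.ofReal (K * e) := by
  have hset : {ω | ∃ x ∈ N, ω ∈ B x} = ⋃ x ∈ N, B x := by ext; simp
  rw [hset]
  calc μ (⋃ x ∈ N, B x) ≤ ∑ x ∈ N, μ (B x) := measure_biUnion_finset_le _ _
    _ ≤ ∑ _x ∈ N, ENNReal.ofReal e := Finset.sum_le_sum hB
    _ = ENNReal.ofReal (N.card * e) := by
        rw [Finset.sum_const, nsmul_eq_mul, ENNReal.ofReal_mul (by positivity),
          ENNReal.ofReal_natCast]
    _ ≤ _ := ENNReal.ofReal_le_ofReal (mul_le_mul_of_nonneg_right hN he)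

-- Markov's inequality for the total weight of the indices `j` with `ω ∈ B j`. No union bound over
-- `j` is taken, so the estimate does not depend on the number of indices. The `B j` need not be
-- measurable, hence the measurable hulls.
open Classical in
theorem measure_weighted_good_lt_half_le [Fintype J] {v : J → ℝ} (hv : ∀ j, 0 ≤ v j) {B : J → Set Ω}
    {e : ℝ} (hB : ∀ j, μ (B j) ≤ ENNReal.ofReal e) :
    μ {ω | ∑ j, (if ω ∈ B j then 0 else v j) < (∑ j, v j) / 2} ≤ ENNReal.ofReal (2 * e) := by
  set V := ∑ j, v j with hVdef
  have hV0 : 0 ≤ V := Finset.sum_nonneg fun j _ => hv j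
  rcases hV0.eq_or_lt with hV | hV
  · have hv0 : ∀ j, v j = 0 := fun j =>
      (Finset.sum_eq_zero_iff_of_nonneg fun j _ => hv j).1 hV.symm j (Finset.mem_univ j)
    simp [hv0, ← hV]
  let f : Ω → ENNReal := fun ω => ∑ j, (toMeasurable μ (B j)).indicator
    (fun _ => ENNReal.ofReal (v j)) ω
  have hf : Measurable f := Finset.measurable_sum _ fun j _ =>
    measurable_const.indicator (measurableSet_toMeasurable _ _)
  have hsub : {ω | ∑ j, (if ω ∈ B j then 0 else v j) < V / 2} ⊆ {ω | ENNReal.ofReal (V / 2) ≤ f ω} := by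
    intro ω hω
    simp only [Set.mem_ofPred_eq] at hω ⊢
    calc ENNReal.ofReal (V / 2) ≤ ENNReal.ofReal (∑ j, if ω ∈ B j then v j else 0) := by
          apply ENNReal.ofReal_le_ofReal
          have : V = ∑ j, (if ω ∈ B j then 0 else v j) + ∑ j, if ω ∈ B j then v j else 0 := by
            rw [← Finset.sum_add_distrib]
            exact Finset.sum_congr rfl fun j _ => by split_ifs <;> simp
          linarith
      _ = ∑ j, ENNReal.ofReal (if ω ∈ B j then v j else 0) :=
          ENNReal.ofReal_sum_of_nonneg fun j _ => by split_ifs <;> simp [hv j]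
      _ ≤ f ω := by
          refine Finset.sum_le_sum fun j _ => ?_
          by_cases hj : ω ∈ B j
          · rw [if_pos hj, Set.indicator_of_mem (subset_toMeasurable _ _ hj)]
          · simp [hj]
  refine (measure_mono hsub).trans ((meas_ge_le_lintegral_div hf.aemeasurable
    (by simpa using hV) ENNReal.ofReal_ne_top).trans ?_)
  have hint : ∫⁻ ω, f ω ∂μ ≤ ENNReal.ofReal (V * e) := by
    rw [lintegral_finsetSum _ fun j _ =>
      measurable_const.indicator (measurableSet_toMeasurable _ _)]
    calc _ = ∑ j, ENNReal.ofReal (v j) * μ (B j) := by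
          refine Finset.sum_congr rfl fun j _ => ?_
          rw [lintegral_indicator_const (measurableSet_toMeasurable _ _), measure_toMeasurable]
      _ ≤ ∑ j, ENNReal.ofReal (v j) * ENNReal.ofReal e := by gcongr with j; exact hB j
      _ = _ := by
          rw [← Finset.sum_mul, ← ENNReal.ofReal_sum_of_nonneg fun j _ => hv j,
            ENNReal.ofReal_mul hV.le]
  refine (ENNReal.div_le_div_right hint _).trans (le_of_eq ?_)
  rw [← ENNReal.ofReal_div_of_pos (by positivity)]
  congr 1
  field_simp

variable [IsProbabilityMeasure μ]

/-- For a fixed unit vector `u`, the combinations `∑ i, u i * g i j` are again independent,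
subgaussian with proxy `c` and of unit variance, so the scalar tail bounds apply. A `1/2`-net
extends the upper bound to the sphere, and a finer net then extends the lower bound. -/
theorem IsSubgaussianArray.measure_not_forall_quadratic_bounds_le [Fintype J]
    (h : IsSubgaussianArray g c μ) (hc : 0 < c) {w : J → ℝ} (hw : ∀ j, 0 ≤ w j) {m : ℝ}
    (hm : 0 < m) (hwm : ∀ j, w j ≤ m) (hV : 0 < ∑ j, w j ^ 2) {C : ℝ} (hC : 0 < C) :
    μ {ω | ¬ ∀ u : EuclideanSpace ℝ I,
        (∑ j, w j) / 16 * ‖u‖ ^ 2 ≤ ∑ j, w j * (∑ i, u i * g i j ω) ^ 2 ∧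
        ∑ j, w j * (∑ i, u i * g i j ω) ^ 2 ≤ 4 * C * (∑ j, w j) * ‖u‖ ^ 2}
      ≤ ENNReal.ofReal
        (5 ^ Fintype.card I * Real.exp (-((C - 2 * c) * (∑ j, w j) / (4 * c * m)))
        + (1 + 16 * √C) ^ Fintype.card I *
          Real.exp (-((∑ j, w j) ^ 2 / (640 * c ^ 2 * ∑ j, w j ^ 2)))) := by
  set W := ∑ j, w j with hWdef
  have hW : 0 ≤ W := Finset.sum_nonneg fun j _ => hw j
  -- With this `ε` the loss `ε · 2√(C W)` in the lower bound is `√W/4`, which leaves `√(W/2) - √W/4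
  -- ≥ √W/4`.
  have hε : 0 < 1 / (8 * √C) := by positivity
  obtain ⟨N₁, hN₁, hnet₁, hcard₁⟩ := exists_sphere_net (EuclideanSpace ℝ I) one_half_pos
  obtain ⟨N₂, hN₂, hnet₂, hcard₂⟩ := exists_sphere_net (EuclideanSpace ℝ I) hε
  rw [finrank_euclideanSpace] at hcard₁ hcard₂
  norm_num at hcard₁
  have hK : 1 + 2 / (1 / (8 * √C)) = 1 + 16 * √C := by field_simp; ring
  rw [hK] at hcard₂
  have hsq : ∀ u : EuclideanSpace ℝ I, ‖u‖ = 1 → ∑ i, u i ^ 2 = 1 := fun u hu => by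
    have := EuclideanSpace.norm_sq_eq u
    rw [hu] at this
    simpa using this.symm
  let B₁ : EuclideanSpace ℝ I → Set Ω := fun u =>
    {ω | C * W ≤ ∑ j, w j * (∑ i, u i * g i j ω) ^ 2}
  let B₂ : EuclideanSpace ℝ I → Set Ω := fun u =>
    {ω | ∑ j, w j * (∑ i, u i * g i j ω) ^ 2 ≤ W / 2}
  have hmeas : ∀ (u : EuclideanSpace ℝ I) j, Measurable fun ω => ∑ i, u i * g i j ω := by
    have := h.measurable
    fun_prop
  have hB₁ := measure_exists_mem_finset_le (μ := μ) N₁ B₁ (Real.exp_pos _).le (fun u hu =>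
    measure_weighted_sum_sq_ge_le (h.iIndepFun_combination u) (hmeas u)
      (h.hasSubgaussianMGF_combination (hsq u (hN₁ u hu))) hc hw hm hwm C) hcard₁
  have hB₂ := measure_exists_mem_finset_le (μ := μ) N₂ B₂ (Real.exp_pos _).le (fun u hu =>
    measure_weighted_sum_sq_le_half_le (h.iIndepFun_combination u) (hmeas u)
      (h.hasSubgaussianMGF_combination (hsq u (hN₂ u hu))) hc
      (h.integral_combination_sq (hsq u (hN₂ u hu))) hw hV) hcard₂
  rw [ENNReal.ofReal_add (by positivity) (by positivity)]
  refine le_trans (measure_mono ?_) ((measure_union_le _ _).trans (add_le_add hB₁ hB₂))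
  intro ω hω
  by_contra hno
  apply hω
  simp only [Set.mem_union, Set.mem_ofPred_eq, not_or, not_exists, not_and, B₁, B₂, not_le] at hno
  obtain ⟨hno₁, hno₂⟩ := hno
  set q := weightedSeminorm (fun i j => g i j ω) w
  have hq : ∀ u, q u ^ 2 = ∑ j, w j * (∑ i, u i * g i j ω) ^ 2 := weightedSeminorm_sq hw
  have hup : ∀ u, q u ≤ 2 * √(C * W) * ‖u‖ := q.le_of_sphere_net hnet₁ fun y hy =>
    Real.le_sqrt_of_sq_le (by rw [hq]; exact (hno₁ y hy).le)
  have hlow := q.ge_of_sphere_net hnet₂ (by positivity) hup (B := √(W / 2)) fun y hy =>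
    Real.sqrt_le_iff.2 ⟨apply_nonneg q y, by rw [hq]; exact (hno₂ y hy).le⟩
  have hlow' : ∀ u, √W / 4 * ‖u‖ ≤ q u := fun u => by
    refine le_trans (mul_le_mul_of_nonneg_right ?_ (norm_nonneg u)) (hlow u)
    have h1 : 1 / (8 * √C) * (2 * √(C * W)) = √W / 4 := by
      rw [Real.sqrt_mul hC.le]; field_simp; ring
    have h2 : √W / 2 ≤ √(W / 2) := by
      apply Real.le_sqrt_of_sq_le
      rw [div_pow, Real.sq_sqrt hW]; linarith
    rw [h1]; linarith
  intro u
  rw [← hq]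
  constructor
  · calc W / 16 * ‖u‖ ^ 2 = (√W / 4 * ‖u‖) ^ 2 := by
          rw [mul_pow, div_pow, Real.sq_sqrt hW]; ring
      _ ≤ _ := pow_le_pow_left₀ (by positivity) (hlow' u) 2
  · calc q u ^ 2 ≤ (2 * √(C * W) * ‖u‖) ^ 2 := pow_le_pow_left₀ (apply_nonneg q u) (hup u) 2
      _ = _ := by rw [mul_pow, mul_pow, Real.sq_sqrt (by positivity)]; ring

theorem five_le_exp_two : (5 : ℝ) ≤ Real.exp 2 := by
  have h := Real.exp_one_gt_d9
  have h2 : Real.exp 2 = Real.exp 1 * Real.exp 1 := by rw [← Real.exp_add]; norm_num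
  nlinarith

/-- The base of the cardinality bound for the nets used for variance proxy `c`. -/
noncomputable def netBase (c : NNReal) : ℝ := 1 + 16 * √(14 * c)

theorem one_lt_netBase (hc : 0 < c) : 1 < netBase c := by
  have : (0 : ℝ) < c := hc
  simp only [netBase]
  have : 0 < √(14 * (c : ℝ)) := by positivity
  linarith

/-- The choice `C = 14 c` makes the first exponent `3n`, which beats the net of size `5^n ≤ e^{2n}`.
Hypothesis `hτ` says that the second exponent beats the finer net with `τ` to spare. -/
theorem IsSubgaussianArray.measure_not_quadratic_bounds_le_exp [Fintype J]
    (h : IsSubgaussianArray g c μ) (hc : 0 < c) {w : J → ℝ} (hw : ∀ j, 0 ≤ w j)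
    (hW : 0 < ∑ j, w j) {n : ℕ} (hn : 0 < n) (hI : Fintype.card I ≤ n)
    (hwn : ∀ j, w j * n ≤ ∑ j, w j) {τ : ℝ}
    (hτ : 640 * c ^ 2 * (∑ j, w j ^ 2) * (Fintype.card I * Real.log (netBase c) + τ)
      ≤ (∑ j, w j) ^ 2) :
    μ {ω | ¬ ∀ u : EuclideanSpace ℝ I,
        (∑ j, w j) / 16 * ‖u‖ ^ 2 ≤ ∑ j, w j * (∑ i, u i * g i j ω) ^ 2 ∧
        ∑ j, w j * (∑ i, u i * g i j ω) ^ 2 ≤ 56 * c * (∑ j, w j) * ‖u‖ ^ 2}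
      ≤ ENNReal.ofReal (Real.exp (-n) + Real.exp (-τ)) := by
  have hc' : (0 : ℝ) < c := hc
  have hn' : (0 : ℝ) < n := by exact_mod_cast hn
  have hV : 0 < ∑ j, w j ^ 2 := by
    obtain ⟨j, -, hj⟩ := Finset.exists_ne_zero_of_sum_ne_zero hW.ne'
    exact Finset.sum_pos' (fun j _ => sq_nonneg _) ⟨j, Finset.mem_univ j, by positivity⟩
  have hmain := h.measure_not_forall_quadratic_bounds_le hc hw (m := (∑ j, w j) / n)
    (by positivity) (fun j => by rw [le_div_iff₀ hn']; exact hwn j) hV (C := 14 * c) (by positivity)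
  have h56 : 4 * (14 * (c : ℝ)) = 56 * c := by ring
  rw [h56] at hmain
  refine hmain.trans (ENNReal.ofReal_le_ofReal (add_le_add ?_ ?_))
  · have he : (14 * (c : ℝ) - 2 * c) * (∑ j, w j) / (4 * c * ((∑ j, w j) / n)) = 3 * n := by
      field_simp; ring
    rw [he]
    calc (5 : ℝ) ^ Fintype.card I * Real.exp (-(3 * n))
        ≤ Real.exp 2 ^ n * Real.exp (-(3 * n)) := by
          gcongr
          calc (5 : ℝ) ^ Fintype.card I ≤ 5 ^ n := pow_le_pow_right₀ (by norm_num) hI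
            _ ≤ _ := pow_le_pow_left₀ (by norm_num) five_le_exp_two n
      _ = Real.exp (-n) := by
          rw [← Real.exp_nat_mul, ← Real.exp_add]; congr 1; ring
  · have hK : 0 < netBase c := zero_lt_one.trans (one_lt_netBase hc)
    rw [show 1 + 16 * √(14 * (c : ℝ)) = Real.exp (Real.log (netBase c)) from
      (Real.exp_log hK).symm, ← Real.exp_nat_mul, ← Real.exp_add]
    apply Real.exp_le_exp.2
    rw [mul_comm, ← le_div_iff₀ (by positivity)] at hτ
    linarith

theorem IsSubgaussianArray.lintegral_exp_sum_col_sq_le (h : IsSubgaussianArray g c μ)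
    (hc : 0 < c) (j : J) :
    ∫⁻ ω, ENNReal.ofReal (Real.exp (∑ i, 1 / (4 * c) * g i j ω ^ 2)) ∂μ
      ≤ ENNReal.ofReal (Real.exp (Fintype.card I / 2)) := by
  have hc' : (0 : ℝ) < c := hc
  have hi : iIndepFun (fun i ω => g i j ω) μ :=
    h.indep.precomp (g := fun i : I => (i, j)) (Prod.mk_left_injective j)
  rw [hi.lintegral_exp_sum_sq (fun i => h.measurable i j)]
  refine (prod_ofReal_exp_le fun i => (h.subgaussian i j).lintegral_exp_mul_sq_le
    (h.measurable i j) (by positivity) (by field_simp; rfl)).trans (le_of_eq ?_)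
  congr 2
  rw [Finset.sum_const, nsmul_eq_mul, Finset.card_univ]
  field_simp
  norm_num

/-- Jensen's inequality bounds the exponential of a weighted average of column norms by the average
of their exponential moments. Hence the average concentrates as well as a single column, with no
dependence on the number of columns and without using their independence. -/
theorem IsSubgaussianArray.measure_weighted_norm_sq_gt_le [Fintype J] (h : IsSubgaussianArray g c μ)
    (hc : 0 < c) {v : J → ℝ} (hv : ∀ j, 0 ≤ v j) :
    μ {ω | 14 * c * Fintype.card I * ∑ j, v j < ∑ j, v j * ∑ i, g i j ω ^ 2}
      ≤ ENNReal.ofReal (Real.exp (-(Fintype.card I))) := by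
  have hc' : (0 : ℝ) < c := hc
  set V := ∑ j, v j with hVdef
  have hV0 : 0 ≤ V := Finset.sum_nonneg fun j _ => hv j
  rcases hV0.eq_or_lt with hV | hV
  · have hv0 : ∀ j, v j = 0 := fun j =>
      (Finset.sum_eq_zero_iff_of_nonneg fun j _ => hv j).1 hV.symm j (Finset.mem_univ j)
    simp [hv0, ← hV]
  set n : ℝ := (Fintype.card I : ℝ)
  have hm := h.measurable
  -- Dividing by `4 c V` turns the threshold `14 c n V` into `7n/2`; the moment costs `e^{n/2}`, so
  -- `e^{-3n}` remains.
  have hsub : {ω | 14 * c * n * V < ∑ j, v j * ∑ i, g i j ω ^ 2}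
      ⊆ {ω | 7 / 2 * n ≤ ∑ j, v j / V * ∑ i, 1 / (4 * c) * g i j ω ^ 2} := by
    intro ω hω
    simp only [Set.mem_ofPred_eq] at hω ⊢
    have : ∑ j, v j / V * ∑ i, 1 / (4 * c) * g i j ω ^ 2
        = (∑ j, v j * ∑ i, g i j ω ^ 2) / (4 * c * V) := by
      rw [Finset.sum_div]
      refine Finset.sum_congr rfl fun j _ => ?_
      rw [← Finset.mul_sum]
      field_simp
    rw [this, le_div_iff₀ (by positivity)]
    linarith
  refine (measure_mono hsub).trans
    ((measure_ge_le_exp_mul_lintegral_exp (by fun_prop) _).trans ?_)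
  have hle : ∫⁻ ω, ENNReal.ofReal
      (Real.exp (∑ j, v j / V * ∑ i, 1 / (4 * c) * g i j ω ^ 2)) ∂μ
      ≤ ENNReal.ofReal (Real.exp (n / 2)) := by
    calc _ ≤ ∫⁻ ω, ∑ j, ENNReal.ofReal (v j / V) *
            ENNReal.ofReal (Real.exp (∑ i, 1 / (4 * c) * g i j ω ^ 2)) ∂μ := by
          refine lintegral_mono fun ω => ?_
          have := convexOn_exp.map_sum_le (t := Finset.univ) (w := fun j => v j / V)
            (p := fun j => ∑ i, 1 / (4 * c) * g i j ω ^ 2) (fun j _ => div_nonneg (hv j) hV.le)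
            (by rw [← Finset.sum_div, ← hVdef, div_self hV.ne']) (by simp)
          simp only [smul_eq_mul] at this
          refine (ENNReal.ofReal_le_ofReal this).trans (le_of_eq ?_)
          rw [ENNReal.ofReal_sum_of_nonneg fun j _ =>
            mul_nonneg (div_nonneg (hv j) hV.le) (Real.exp_pos _).le]
          exact Finset.sum_congr rfl fun j _ => ENNReal.ofReal_mul (div_nonneg (hv j) hV.le)
      _ = ∑ j, ENNReal.ofReal (v j / V) *
            ∫⁻ ω, ENNReal.ofReal (Real.exp (∑ i, 1 / (4 * c) * g i j ω ^ 2)) ∂μ := by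
          rw [lintegral_finsetSum _ fun j _ => by fun_prop]
          exact Finset.sum_congr rfl fun j _ => lintegral_const_mul _ (by fun_prop)
      _ ≤ ∑ j, ENNReal.ofReal (v j / V) * ENNReal.ofReal (Real.exp (n / 2)) := by
          gcongr with j
          exact h.lintegral_exp_sum_col_sq_le hc j
      _ = _ := by
          rw [← Finset.sum_mul, ← ENNReal.ofReal_sum_of_nonneg fun j _ => div_nonneg (hv j) hV.le,
            ← Finset.sum_div, ← hVdef, div_self hV.ne', ENNReal.ofReal_one, one_mul]
  refine (mul_le_mul_right hle _).trans ?_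
  rw [← ENNReal.ofReal_mul (by positivity), ← Real.exp_add]
  apply ENNReal.ofReal_le_ofReal
  have : 0 ≤ n := Nat.cast_nonneg _
  apply Real.exp_le_exp.2
  linarith

end UniformBounds

/-! ### Resolvent estimates for Gram operators with a well-conditioned tail -/

section GramOperator

variable {F : Type*} [NormedAddCommGroup F] [InnerProductSpace ℝ F] {ι : Type*}

/-- The operator `u ↦ ∑_{l ∈ T} λ_l ⟪z_l, u⟫ z_l + μ u`. -/
noncomputable def gramOp (z : ι → F) (l : ι → ℝ) (T : Finset ι) (μ : ℝ) : F →ₗ[ℝ] F :=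
  ∑ j ∈ T, (l j) • ((innerₗ F (z j)).smulRight (z j)) + μ • LinearMap.id

theorem gramOp_apply (z : ι → F) (l : ι → ℝ) (T : Finset ι) (μ : ℝ) (u : F) :
    gramOp z l T μ u = ∑ j ∈ T, (l j * ⟪z j, u⟫_ℝ) • z j + μ • u := by
  simp [gramOp, smul_smul]

theorem inner_gramOp (z : ι → F) (l : ι → ℝ) (T : Finset ι) (μ : ℝ) (u v : F) :
    ⟪v, gramOp z l T μ u⟫_ℝ = ∑ j ∈ T, l j * ⟪z j, u⟫_ℝ * ⟪z j, v⟫_ℝ + μ * ⟪v, u⟫_ℝ := by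
  rw [gramOp_apply, inner_add_right, inner_sum, real_inner_smul_right]
  simp only [real_inner_smul_right, real_inner_comm v]

theorem inner_gramOp_self (z : ι → F) (l : ι → ℝ) (T : Finset ι) (μ : ℝ) (u : F) :
    ⟪u, gramOp z l T μ u⟫_ℝ = ∑ j ∈ T, l j * ⟪z j, u⟫_ℝ ^ 2 + μ * ‖u‖ ^ 2 := by
  rw [inner_gramOp, real_inner_self_eq_norm_sq]
  simp only [pow_two, mul_assoc]

theorem inner_gramOp_comm (z : ι → F) (l : ι → ℝ) (T : Finset ι) (μ : ℝ) (u v : F) :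
    ⟪v, gramOp z l T μ u⟫_ℝ = ⟪gramOp z l T μ v, u⟫_ℝ := by
  rw [real_inner_comm u, inner_gramOp, inner_gramOp, real_inner_comm u v]
  congr 1
  exact Finset.sum_congr rfl fun j _ => by ring

theorem gramOp_union [DecidableEq ι] (z : ι → F) (l : ι → ℝ) {H T : Finset ι} (h : Disjoint H T)
    (μ : ℝ) (u : F) :
    gramOp z l (H ∪ T) μ u = gramOp z l T μ u + ∑ j ∈ H, (l j * ⟪z j, u⟫_ℝ) • z j := by
  rw [gramOp_apply, gramOp_apply, Finset.sum_union h]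
  abel

/-- `‖D u‖² ≤ d ⟪u, D u⟫` when `0 ≤ D ≤ d`. -/
theorem norm_sq_gramOp_le {z : ι → F} {l : ι → ℝ} {T : Finset ι} {μ d : ℝ} (hd : 0 < d)
    (h0 : ∀ u, 0 ≤ ⟪u, gramOp z l T μ u⟫_ℝ) (hD : ∀ u, ⟪u, gramOp z l T μ u⟫_ℝ ≤ d * ‖u‖ ^ 2)
    (u : F) : ‖gramOp z l T μ u‖ ^ 2 ≤ d * ⟪u, gramOp z l T μ u⟫_ℝ := by
  set f := gramOp z l T μ u with hf
  -- Positivity of `D` is tested at `d u - D u`, and the resulting term `⟪D u, D (D u)⟫` is at most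
  -- `d ‖D u‖²`.
  have h1 := h0 (d • u - f)
  rw [map_sub, map_smul, ← hf, inner_sub_left, inner_sub_right, inner_sub_right,
    real_inner_smul_left, real_inner_smul_left, real_inner_smul_right, real_inner_smul_right,
    inner_gramOp_comm z l T μ f u, ← hf, real_inner_self_eq_norm_sq] at h1
  have h2 := hD f
  have h3 : 0 ≤ d * (d * ⟪u, f⟫_ℝ - ‖f‖ ^ 2) := by nlinarith
  have h4 := nonneg_of_mul_nonneg_right h3 hd
  linarith

/-- The tail operator `∑_{l ∈ T} λ_l z_l z_lᵀ + μ` has its spectrum in `[d₁, d₂]`, and the Gram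
matrix of the `z_i`, `i ∈ H`, is at least `κ`. -/
structure IsSpiked (z : ι → F) (l : ι → ℝ) (H T : Finset ι) (μ d₁ d₂ κ : ℝ) : Prop where
  disjoint : Disjoint H T
  pos : ∀ j, 0 < l j
  d₁_pos : 0 < d₁
  κ_pos : 0 < κ
  μ_nonneg : 0 ≤ μ
  lower : ∀ u, d₁ * ‖u‖ ^ 2 ≤ ⟪u, gramOp z l T μ u⟫_ℝ
  upper : ∀ u, ⟪u, gramOp z l T μ u⟫_ℝ ≤ d₂ * ‖u‖ ^ 2
  d₂_pos : 0 < d₂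
  head : ∀ a : ι → ℝ, κ * ∑ i ∈ H, a i ^ 2 ≤ ‖∑ i ∈ H, a i • z i‖ ^ 2

namespace IsSpiked

variable {z : ι → F} {l : ι → ℝ} {H T : Finset ι} {μ d₁ d₂ κ : ℝ}

theorem norm_sq_le (h : IsSpiked z l H T μ d₁ d₂ κ) (u : F) :
    ‖gramOp z l T μ u‖ ^ 2 ≤ d₂ * ⟪u, gramOp z l T μ u⟫_ℝ :=
  norm_sq_gramOp_le h.d₂_pos
    (fun u => (mul_nonneg h.d₁_pos.le (sq_nonneg _)).trans (h.lower u)) h.upper u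

theorem energy_nonneg (h : IsSpiked z l H T μ d₁ d₂ κ) (u : F) : 0 ≤ ⟪u, gramOp z l T μ u⟫_ℝ :=
  (mul_nonneg h.d₁_pos.le (sq_nonneg _)).trans (h.lower u)

theorem tail_sum_le (h : IsSpiked z l H T μ d₁ d₂ κ) {m : ℝ} (hm0 : 0 ≤ m) (hm : ∀ j ∈ T, l j ≤ m) (u : F) :
    ∑ j ∈ T, l j ^ 2 * ⟪z j, u⟫_ℝ ^ 2 ≤ m * ⟪u, gramOp z l T μ u⟫_ℝ := by
  rw [inner_gramOp_self, mul_add, Finset.mul_sum]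
  have h1 : 0 ≤ m * (μ * ‖u‖ ^ 2) := mul_nonneg hm0 (mul_nonneg h.μ_nonneg (sq_nonneg _))
  have h2 : ∑ j ∈ T, l j ^ 2 * ⟪z j, u⟫_ℝ ^ 2 ≤ ∑ j ∈ T, m * (l j * ⟪z j, u⟫_ℝ ^ 2) := by
    refine Finset.sum_le_sum fun j hj => ?_
    have := mul_le_mul_of_nonneg_right (hm j hj)
      (mul_nonneg (h.pos j).le (sq_nonneg ⟪z j, u⟫_ℝ))
    calc l j ^ 2 * ⟪z j, u⟫_ℝ ^ 2 = l j * (l j * ⟪z j, u⟫_ℝ ^ 2) := by ring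
      _ ≤ _ := this
  linarith

variable [DecidableEq ι] {q : F}

/-- The energy identity for the equation `B q = y`. -/
theorem energy_add (h : IsSpiked z l H T μ d₁ d₂ κ) {y : F}
    (hq : gramOp z l (H ∪ T) μ q = y) :
    ⟪q, gramOp z l T μ q⟫_ℝ + ∑ j ∈ H, l j * ⟪z j, q⟫_ℝ ^ 2 = ⟪y, q⟫_ℝ := by
  rw [← hq, gramOp_union z l h.disjoint, inner_add_left, sum_inner, real_inner_comm]
  congr 1
  refine Finset.sum_congr rfl fun j _ => ?_
  rw [real_inner_smul_left]; ring

theorem energy_le_inner (h : IsSpiked z l H T μ d₁ d₂ κ) {y : F}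
    (hq : gramOp z l (H ∪ T) μ q = y) : ⟪q, gramOp z l T μ q⟫_ℝ ≤ ⟪y, q⟫_ℝ := by
  rw [← h.energy_add hq]
  exact le_add_of_nonneg_right
    (Finset.sum_nonneg fun j _ => mul_nonneg (h.pos j).le (sq_nonneg _))

/-- Moving the head terms to the other side shows that the tail operator sends `q` into the span of
the head columns. The coefficients there can then be read off through the conditioning constant `κ`.
-/
theorem gramOp_eq_head_sum (h : IsSpiked z l H T μ d₁ d₂ κ) {i : ι} (hi : i ∈ H)
    (hq : gramOp z l (H ∪ T) μ q = z i) :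
    gramOp z l T μ q = ∑ j ∈ H, ((if j = i then 1 else 0) - l j * ⟪z j, q⟫_ℝ) • z j := by
  simp only [sub_smul, Finset.sum_sub_distrib]
  rw [eq_sub_iff_add_eq, ← gramOp_union z l h.disjoint, hq]
  simp [ite_smul, hi]

theorem head_residual_le (h : IsSpiked z l H T μ d₁ d₂ κ) {i : ι} (hi : i ∈ H)
    (hq : gramOp z l (H ∪ T) μ q = z i) :
    κ * ∑ j ∈ H, ((if j = i then 1 else 0) - l j * ⟪z j, q⟫_ℝ) ^ 2
      ≤ d₂ * ⟪q, gramOp z l T μ q⟫_ℝ := by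
  refine (h.head _).trans ?_
  rw [← h.gramOp_eq_head_sum hi hq]
  exact h.norm_sq_le q

theorem head_diag_residual_le (h : IsSpiked z l H T μ d₁ d₂ κ) {i : ι} (hi : i ∈ H)
    (hq : gramOp z l (H ∪ T) μ q = z i) :
    κ * (1 - l i * ⟪z i, q⟫_ℝ) ^ 2 ≤ d₂ * ⟪q, gramOp z l T μ q⟫_ℝ := by
  refine le_trans (mul_le_mul_of_nonneg_left ?_ h.κ_pos.le) (h.head_residual_le hi hq)
  have := Finset.single_le_sum (s := H)
    (f := fun j => ((if j = i then 1 else 0) - l j * ⟪z j, q⟫_ℝ) ^ 2) (fun j _ => sq_nonneg _) hi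
  simpa using this

/-- With `g = ⟪z_i, q⟫` and energy `E`, the energy identity gives `l E ≤ l g (1 - l g) ≤ 1 - l g`,
while the residual bound gives `κ (1 - l g)² ≤ d₂ E`. Together `κ l² E² ≤ d₂ E`, and one factor `E`
cancels. -/
theorem head_energy_le (h : IsSpiked z l H T μ d₁ d₂ κ) {i : ι} (hi : i ∈ H)
    (hq : gramOp z l (H ∪ T) μ q = z i) :
    κ * l i ^ 2 * ⟪q, gramOp z l T μ q⟫_ℝ ≤ d₂ := by
  have h1 := h.head_diag_residual_le hi hq
  have h2 := h.energy_add hq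
  have h3 : l i * ⟪z i, q⟫_ℝ ^ 2 ≤ ∑ j ∈ H, l j * ⟪z j, q⟫_ℝ ^ 2 :=
    Finset.single_le_sum (f := fun j => l j * ⟪z j, q⟫_ℝ ^ 2)
      (fun j _ => mul_nonneg (h.pos j).le (sq_nonneg _)) hi
  have hE := h.energy_nonneg q
  have hl := h.pos i
  set E := ⟪q, gramOp z l T μ q⟫_ℝ
  set g := ⟪z i, q⟫_ℝ
  have h4 : E ≤ g * (1 - l i * g) := by nlinarith
  have h5 : l i * E ≤ 1 - l i * g := by
    have : l i * E ≤ (l i * g) * (1 - l i * g) := by nlinarith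
    nlinarith [sq_nonneg (1 - l i * g)]
  have h6 : (l i * E) ^ 2 ≤ (1 - l i * g) ^ 2 :=
    pow_le_pow_left₀ (mul_nonneg hl.le hE) h5 2
  have h7 : κ * (l i * E) ^ 2 ≤ d₂ * E := (mul_le_mul_of_nonneg_left h6 h.κ_pos.le).trans h1
  rcases hE.eq_or_lt with h0 | h0
  · rw [← h0, mul_zero]; exact h.d₂_pos.le
  · have : (κ * l i ^ 2 * E) * E ≤ d₂ * E := by linarith [h7, show (l i * E) ^ 2 * κ = (κ * l i ^ 2 * E) * E by ring]
    exact le_of_mul_le_mul_right this h0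

theorem head_norm_sq_le (h : IsSpiked z l H T μ d₁ d₂ κ) {i : ι} (hi : i ∈ H)
    (hq : gramOp z l (H ∪ T) μ q = z i) : l i ^ 2 * ‖q‖ ^ 2 ≤ d₂ / (d₁ * κ) := by
  rw [le_div_iff₀ (mul_pos h.d₁_pos h.κ_pos)]
  have h1 := h.head_energy_le hi hq
  have h2 := mul_le_mul_of_nonneg_left (h.lower q) (mul_nonneg h.κ_pos.le (sq_nonneg (l i)))
  linarith

theorem head_residual_le' (h : IsSpiked z l H T μ d₁ d₂ κ) {i : ι} (hi : i ∈ H)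
    (hq : gramOp z l (H ∪ T) μ q = z i) :
    l i ^ 2 * ∑ j ∈ H, ((if j = i then 1 else 0) - l j * ⟪z j, q⟫_ℝ) ^ 2 ≤ d₂ ^ 2 / κ ^ 2 := by
  rw [le_div_iff₀ (pow_pos h.κ_pos 2)]
  have h1 := mul_le_mul_of_nonneg_left (h.head_residual_le hi hq)
    (mul_nonneg h.κ_pos.le (sq_nonneg (l i)))
  have h2 := mul_le_mul_of_nonneg_left (h.head_energy_le hi hq) h.d₂_pos.le
  linarith

theorem head_tail_sum_le (h : IsSpiked z l H T μ d₁ d₂ κ) {m : ℝ} (hm0 : 0 ≤ m)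
    (hm : ∀ j ∈ T, l j ≤ m) {i : ι} (hi : i ∈ H) (hq : gramOp z l (H ∪ T) μ q = z i) :
    l i ^ 2 * ∑ j ∈ T, l j ^ 2 * ⟪z j, q⟫_ℝ ^ 2 ≤ m * d₂ / κ := by
  rw [le_div_iff₀ h.κ_pos]
  have h1 := mul_le_mul_of_nonneg_left (h.tail_sum_le hm0 hm q)
    (mul_nonneg h.κ_pos.le (sq_nonneg (l i)))
  have h2 := mul_le_mul_of_nonneg_left (h.head_energy_le hi hq) hm0
  linarith

/-- `E ≤ ⟪y, q⟫ ≤ ‖y‖ ‖q‖` and `d₁ ‖q‖² ≤ E`; squaring the first and cancelling `E` gives the bound.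
-/
theorem energy_le_norm_sq (h : IsSpiked z l H T μ d₁ d₂ κ) {y : F}
    (hq : gramOp z l (H ∪ T) μ q = y) : d₁ * ⟪q, gramOp z l T μ q⟫_ℝ ≤ ‖y‖ ^ 2 := by
  have h1 := h.energy_le_inner hq
  have h2 := real_inner_le_norm y q
  have h3 := h.lower q
  have hE := h.energy_nonneg q
  set E := ⟪q, gramOp z l T μ q⟫_ℝ
  have h4 : E ^ 2 ≤ (‖y‖ * ‖q‖) ^ 2 := pow_le_pow_left₀ hE (h1.trans h2) 2
  have h5 : d₁ * E ^ 2 ≤ ‖y‖ ^ 2 * E := by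
    calc d₁ * E ^ 2 ≤ d₁ * (‖y‖ * ‖q‖) ^ 2 := mul_le_mul_of_nonneg_left h4 h.d₁_pos.le
      _ = ‖y‖ ^ 2 * (d₁ * ‖q‖ ^ 2) := by ring
      _ ≤ _ := mul_le_mul_of_nonneg_left h3 (sq_nonneg _)
  rcases hE.eq_or_lt with h0 | h0
  · rw [← h0, mul_zero]; positivity
  · have : (d₁ * E) * E ≤ ‖y‖ ^ 2 * E := by linarith [show (d₁ * E) * E = d₁ * E ^ 2 by ring]
    exact le_of_mul_le_mul_right this h0

theorem norm_sq_solution_le (h : IsSpiked z l H T μ d₁ d₂ κ) {y : F}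
    (hq : gramOp z l (H ∪ T) μ q = y) : ‖q‖ ^ 2 ≤ ‖y‖ ^ 2 / d₁ ^ 2 := by
  rw [le_div_iff₀ (pow_pos h.d₁_pos 2)]
  have h1 := h.energy_le_norm_sq hq
  have h2 := mul_le_mul_of_nonneg_left (h.lower q) h.d₁_pos.le
  linarith

theorem sum_sq_solution_le (h : IsSpiked z l H T μ d₁ d₂ κ) {m : ℝ} (hm0 : 0 ≤ m)
    (hm : ∀ j ∈ T, l j ≤ m) {y : F} (hq : gramOp z l (H ∪ T) μ q = y) :
    ∑ j ∈ H ∪ T, l j ^ 2 * ⟪z j, q⟫_ℝ ^ 2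
      ≤ ((2 + 2 * d₂ / d₁) / κ + m / d₁) * ‖y‖ ^ 2 := by
  rw [Finset.sum_union h.disjoint, add_mul]
  have hE : ⟪q, gramOp z l T μ q⟫_ℝ ≤ ‖y‖ ^ 2 / d₁ := by
    rw [le_div_iff₀ h.d₁_pos, mul_comm]; exact h.energy_le_norm_sq hq
  refine add_le_add ?_ ?_
  · have h1 := h.head fun j => l j * ⟪z j, q⟫_ℝ
    -- The head part of the equation is `y - D q`, so the conditioning of the head controls the
    -- coefficients `l j * ⟪z j, q⟫`.
    have h2 : ∑ j ∈ H, (l j * ⟪z j, q⟫_ℝ) • z j = y - gramOp z l T μ q := by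
      rw [eq_sub_iff_add_eq', ← gramOp_union z l h.disjoint, hq]
    rw [h2] at h1
    have h3 : ‖y - gramOp z l T μ q‖ ^ 2 ≤ 2 * (‖y‖ ^ 2 + ‖gramOp z l T μ q‖ ^ 2) := by
      have := parallelogram_law_with_norm ℝ y (gramOp z l T μ q)
      nlinarith [sq_nonneg ‖y + gramOp z l T μ q‖]
    have h4 := h.norm_sq_le q
    have h5 := mul_le_mul_of_nonneg_left hE h.d₂_pos.le
    simp only [mul_pow] at h1
    rw [div_mul_eq_mul_div, le_div_iff₀ h.κ_pos]
    have h6 : (2 + 2 * d₂ / d₁) * ‖y‖ ^ 2 = 2 * ‖y‖ ^ 2 + 2 * (d₂ * (‖y‖ ^ 2 / d₁)) := by ring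
    rw [h6]
    linarith
  · refine (h.tail_sum_le hm0 hm q).trans ?_
    rw [div_mul_eq_mul_div, mul_div_assoc]
    exact mul_le_mul_of_nonneg_left hE hm0

/-- From `κ (1 - l g)² ≤ d₂ g`: either `l g ≥ 1/2`, or the left side exceeds `κ/4`. -/
theorem diag_ge_of_mem_head (h : IsSpiked z l H T μ d₁ d₂ κ) {i : ι} (hi : i ∈ H)
    (hq : gramOp z l (H ∪ T) μ q = z i) :
    min (1 / (2 * l i)) (κ / (4 * d₂)) ≤ ⟪z i, q⟫_ℝ := by
  have h1 := (h.head_diag_residual_le hi hq).trans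
    (mul_le_mul_of_nonneg_left (h.energy_le_inner hq) h.d₂_pos.le)
  have hl := h.pos i
  by_contra! hlt
  obtain ⟨h2, h3⟩ := lt_min_iff.1 hlt
  rw [lt_div_iff₀ (by positivity)] at h2
  rw [lt_div_iff₀ (mul_pos (by norm_num) h.d₂_pos)] at h3
  have h4 : 1 / 2 < 1 - l i * ⟪z i, q⟫_ℝ := by linarith
  have h5 : 1 / 4 < (1 - l i * ⟪z i, q⟫_ℝ) ^ 2 := by nlinarith
  nlinarith [h.κ_pos]

/-- `D q` is `z_i` minus a combination of head columns, so its coefficient on `z_i` is `1`.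
Conditioning of the head enlarged by `z_i` gives `κ ≤ ‖D q‖² ≤ d₂ ⟪z_i, q⟫`. -/
theorem diag_ge_of_notMem_head (h : IsSpiked z l H T μ d₁ d₂ κ) {i : ι} (hi : i ∉ H)
    (hins : ∀ a : ι → ℝ, κ * ∑ j ∈ insert i H, a j ^ 2 ≤ ‖∑ j ∈ insert i H, a j • z j‖ ^ 2)
    (hq : gramOp z l (H ∪ T) μ q = z i) : κ / d₂ ≤ ⟪z i, q⟫_ℝ := by
  rw [div_le_iff₀ h.d₂_pos, mul_comm]
  have h1 := hins fun j => if j = i then 1 else - (l j * ⟪z j, q⟫_ℝ)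
  rw [Finset.sum_insert hi, Finset.sum_insert hi] at h1
  have h2 : ∑ j ∈ H, (if j = i then (1 : ℝ) else - (l j * ⟪z j, q⟫_ℝ)) • z j
      = - ∑ j ∈ H, (l j * ⟪z j, q⟫_ℝ) • z j := by
    rw [← Finset.sum_neg_distrib]
    refine Finset.sum_congr rfl fun j hj => ?_
    rw [if_neg (show j ≠ i from fun h' => hi (h' ▸ hj)), neg_smul]
  have h3 : gramOp z l T μ q = z i - ∑ j ∈ H, (l j * ⟪z j, q⟫_ℝ) • z j := by
    rw [eq_sub_iff_add_eq, ← gramOp_union z l h.disjoint, hq]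
  rw [h2, if_pos rfl, one_smul, ← sub_eq_add_neg, ← h3] at h1
  have h4 := (h.norm_sq_le q).trans
    (mul_le_mul_of_nonneg_left (h.energy_le_inner hq) h.d₂_pos.le)
  have h5 : 0 ≤ ∑ j ∈ H, (if j = i then (1 : ℝ) else - (l j * ⟪z j, q⟫_ℝ)) ^ 2 :=
    Finset.sum_nonneg fun j _ => sq_nonneg _
  nlinarith [mul_nonneg h.κ_pos.le h5]

end IsSpiked

end GramOperator

/-! ### Deterministic risk and norm bounds for ridge regression -/

section GoodDesign

variable {F : Type*} [NormedAddCommGroup F] [InnerProductSpace ℝ F] {ι : Type*} [DecidableEq ι]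

/-- The normalized feature columns `z` behave as in the benign overfitting regime: the tail Gram
operator is comparable to its trace `∑_{j ∈ T} λ_j`, the head columns are well-conditioned, and for
the weights at hand the tail columns are on average neither too long nor too close to the span of
the head columns. Here `t j` stands for the squared coefficient of the signal. -/
structure IsGoodDesign [Fintype ι] (z : ι → F) (l t : ι → ℝ) (H T : Finset ι) (n K : ℝ) :
    Prop where
  disjoint : Disjoint H T
  union_eq : H ∪ T = Finset.univ
  pos : ∀ j, 0 < l j
  nonneg : ∀ j, 0 ≤ t j
  n_pos : 0 < n
  one_le : 1 ≤ K
  trace_pos : 0 < ∑ j ∈ T, l j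
  le_trace : ∀ j ∈ T, l j * n ≤ ∑ j ∈ T, l j
  tail_lower : ∀ u, (∑ j ∈ T, l j) / 16 * ‖u‖ ^ 2 ≤ ∑ j ∈ T, l j * ⟪z j, u⟫_ℝ ^ 2
  tail_upper : ∀ u, ∑ j ∈ T, l j * ⟪z j, u⟫_ℝ ^ 2 ≤ K * (∑ j ∈ T, l j) * ‖u‖ ^ 2
  head_lower : ∀ a : ι → ℝ, n / 16 * ∑ i ∈ H, a i ^ 2 ≤ ‖∑ i ∈ H, a i • z i‖ ^ 2
  head_norm : ∀ i ∈ H, ‖z i‖ ^ 2 ≤ K * n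
  noise_weights : ∑ j ∈ T, l j ^ 2 * ‖z j‖ ^ 2 ≤ K * n * ∑ j ∈ T, l j ^ 2
  signal_weights : ∑ j ∈ T, l j * t j * ‖z j‖ ^ 2 ≤ K * n * ∑ j ∈ T, l j * t j
  exists_good : ∃ G ⊆ T, (∀ j ∈ G, ‖z j‖ ^ 2 ≤ K * n ∧ ∀ a : ι → ℝ,
      n / 16 * ∑ i ∈ insert j H, a i ^ 2 ≤ ‖∑ i ∈ insert j H, a i • z i‖ ^ 2) ∧
    (∑ j ∈ T, l j) / 2 ≤ ∑ j ∈ G, l j ∧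
    (∑ j ∈ T, t j * l j ^ 2) / 2 ≤ ∑ j ∈ G, t j * l j ^ 2

namespace IsGoodDesign

variable [Fintype ι] {z : ι → F} {l t : ι → ℝ} {H T : Finset ι} {n K : ℝ}

theorem isSpiked (h : IsGoodDesign z l t H T n K) {μ : ℝ} (hμ : 0 ≤ μ) :
    IsSpiked z l H T μ ((∑ j ∈ T, l j + μ) / 16) (K * (∑ j ∈ T, l j + μ)) (n / 16) where
  disjoint := h.disjoint
  pos := h.pos
  d₁_pos := by have := h.trace_pos; positivity
  κ_pos := by have := h.n_pos; positivity
  μ_nonneg := hμ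
  lower u := by
    rw [inner_gramOp_self]
    have := h.tail_lower u
    nlinarith [mul_nonneg hμ (sq_nonneg ‖u‖)]
  upper u := by
    rw [inner_gramOp_self]
    have := h.tail_upper u
    nlinarith [mul_nonneg (sub_nonneg.2 h.one_le) (mul_nonneg hμ (sq_nonneg ‖u‖))]
  d₂_pos := by have := h.trace_pos; have := h.one_le; positivity
  head := h.head_lower

variable {μ : ℝ} {q : ι → F}

theorem head_bias_le (h : IsGoodDesign z l t H T n K) (hμ : 0 ≤ μ)
    (hq : ∀ j, gramOp z l Finset.univ μ (q j) = z j) {j : ι} (hj : j ∈ H) :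
    ∑ k, l k * ((if k = j then 1 else 0) - √(l k) * √(l j) * ⟪z k, q j⟫_ℝ) ^ 2
      ≤ 544 * K ^ 2 * (((∑ i ∈ T, l i) ^ 2 + μ ^ 2) / n ^ 2 * (1 / l j)) := by
  have hs := h.isSpiked hμ
  have hn := h.n_pos
  have hS := h.trace_pos
  have hK := h.one_le
  set S := ∑ i ∈ T, l i with hSdef
  have hqj : gramOp z l (H ∪ T) μ (q j) = z j := by rw [h.union_eq]; exact hq j
  have hlj := h.pos j
  have hm : ∀ i ∈ T, l i ≤ S / n := fun i hi => by
    rw [le_div_iff₀ hn]; exact h.le_trace i hi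
  -- The diagonal entry is unchanged and off the diagonal only factors are exchanged, so the sum is
  -- `l j` times the head residual plus the tail sum.
  have hterm : ∀ k, l k * ((if k = j then 1 else 0) - √(l k) * √(l j) * ⟪z k, q j⟫_ℝ) ^ 2
      = l j * ((if k = j then 1 else 0) - l k * ⟪z k, q j⟫_ℝ) ^ 2 := fun k => by
    have h1 : √(l k) ^ 2 = l k := Real.sq_sqrt (h.pos k).le
    have h2 : √(l j) ^ 2 = l j := Real.sq_sqrt hlj.le
    by_cases hk : k = j
    · subst hk
      rw [if_pos rfl, ← pow_two, h1]
    · rw [if_neg hk]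
      calc _ = l k * (√(l k) ^ 2 * √(l j) ^ 2 * ⟪z k, q j⟫_ℝ ^ 2) := by ring
        _ = _ := by rw [h1, h2]; ring
  have htail : ∑ k ∈ T, ((if k = j then 1 else 0) - l k * ⟪z k, q j⟫_ℝ) ^ 2
      = ∑ k ∈ T, l k ^ 2 * ⟪z k, q j⟫_ℝ ^ 2 := by
    refine Finset.sum_congr rfl fun k hk => ?_
    have : k ≠ j := fun h' => Finset.disjoint_left.1 h.disjoint hj (h' ▸ hk)
    rw [if_neg this]; ring
  simp only [hterm]
  rw [← Finset.mul_sum, ← h.union_eq, Finset.sum_union h.disjoint, htail]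
  have h1 := hs.head_residual_le' hj hqj
  have h2 := hs.head_tail_sum_le (by positivity) hm hj hqj
  set A := ∑ k ∈ H, ((if k = j then 1 else 0) - l k * ⟪z k, q j⟫_ℝ) ^ 2
  set B := ∑ k ∈ T, l k ^ 2 * ⟪z k, q j⟫_ℝ ^ 2
  have h3 : l j ^ 2 * (A + B) ≤ 544 * K ^ 2 * ((S ^ 2 + μ ^ 2) / n ^ 2) := by
    have e1 : (K * (S + μ)) ^ 2 / (n / 16) ^ 2 = 256 * K ^ 2 * ((S + μ) ^ 2 / n ^ 2) := by
      field_simp; ring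
    have e2 : S / n * (K * (S + μ)) / (n / 16) = 16 * K * (S * (S + μ) / n ^ 2) := by
      field_simp
    rw [e1] at h1
    rw [e2] at h2
    have h4 : 16 * K * (S * (S + μ) / n ^ 2) ≤ 16 * K ^ 2 * ((S + μ) ^ 2 / n ^ 2) := by
      gcongr ?_ * (?_ / _)
      · nlinarith
      · nlinarith
    have h5 : (S + μ) ^ 2 / n ^ 2 ≤ 2 * ((S ^ 2 + μ ^ 2) / n ^ 2) := by
      rw [← mul_div_assoc]
      gcongr
      nlinarith [sq_nonneg (S - μ)]
    have h6 := mul_le_mul_of_nonneg_left h5 (show 0 ≤ 272 * K ^ 2 by positivity)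
    linarith
  rw [mul_one_div, ← mul_div_assoc, le_div_iff₀ hlj]
  calc _ = l j ^ 2 * (A + B) := by ring
    _ ≤ _ := h3

/-- Here `(δ - x)² ≤ 2 δ² + 2 x²` suffices: a tail coordinate is hardly estimated, and its own
variance `l j` is an admissible error. -/
theorem tail_bias_le (h : IsGoodDesign z l t H T n K) (hμ : 0 ≤ μ)
    (hq : ∀ j, gramOp z l Finset.univ μ (q j) = z j) (j : ι) :
    ∑ k, l k * ((if k = j then 1 else 0) - √(l k) * √(l j) * ⟪z k, q j⟫_ℝ) ^ 2
      ≤ 2 * l j + 1120 * K / n * (l j * ‖z j‖ ^ 2) := by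
  have hs := h.isSpiked hμ
  have hn := h.n_pos
  have hS := h.trace_pos
  have hK := h.one_le
  set S := ∑ i ∈ T, l i with hSdef
  have hqj : gramOp z l (H ∪ T) μ (q j) = z j := by rw [h.union_eq]; exact hq j
  have hlj := h.pos j
  have hm : ∀ i ∈ T, l i ≤ S / n := fun i hi => by
    rw [le_div_iff₀ hn]; exact h.le_trace i hi
  have hterm : ∀ k, l k * ((if k = j then 1 else 0) - √(l k) * √(l j) * ⟪z k, q j⟫_ℝ) ^ 2
      ≤ (if k = j then 2 * l j else 0) + 2 * l j * (l k ^ 2 * ⟪z k, q j⟫_ℝ ^ 2) := fun k => by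
    have h1 : √(l k) ^ 2 = l k := Real.sq_sqrt (h.pos k).le
    have h2 : √(l j) ^ 2 = l j := Real.sq_sqrt hlj.le
    have h3 : 2 * l j * (l k ^ 2 * ⟪z k, q j⟫_ℝ ^ 2)
        = l k * (2 * (√(l k) * √(l j) * ⟪z k, q j⟫_ℝ) ^ 2) := by
      calc _ = l k * (2 * (l k * l j * ⟪z k, q j⟫_ℝ ^ 2)) := by ring
        _ = l k * (2 * (√(l k) ^ 2 * √(l j) ^ 2 * ⟪z k, q j⟫_ℝ ^ 2)) := by rw [h1, h2]
        _ = _ := by ring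
    rw [h3]
    generalize √(l k) * √(l j) * ⟪z k, q j⟫_ℝ = x
    by_cases hk : k = j
    · subst hk
      simp only [if_true]
      nlinarith [mul_nonneg hlj.le (sq_nonneg (1 + x))]
    · simp only [if_neg hk]
      nlinarith [mul_nonneg (h.pos k).le (sq_nonneg x)]
  refine (Finset.sum_le_sum fun k _ => hterm k).trans ?_
  rw [Finset.sum_add_distrib, Finset.sum_ite_eq' Finset.univ j, if_pos (Finset.mem_univ j),
    ← Finset.mul_sum, ← h.union_eq]
  have h1 := hs.sum_sq_solution_le (by positivity) hm hqj
  have h2 : (2 + 2 * (K * (S + μ)) / ((S + μ) / 16)) / (n / 16) + S / n / ((S + μ) / 16)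
      ≤ 560 * K / n := by
    have e1 : 2 * (K * (S + μ)) / ((S + μ) / 16) = 32 * K := by field_simp; norm_num
    have e2 : S / n / ((S + μ) / 16) = 16 / n * (S / (S + μ)) := by field_simp
    have e3 : S / (S + μ) ≤ 1 := by rw [div_le_one (by positivity)]; linarith
    have e4 := mul_le_mul_of_nonneg_left e3 (show 0 ≤ 16 / n by positivity)
    rw [e1, e2]
    have e5 : (2 + 32 * K) / (n / 16) = (32 + 512 * K) / n := by field_simp; ring
    rw [e5]
    have e6 : (32 + 512 * K) / n + 16 / n ≤ 560 * K / n := by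
      rw [← add_div]; gcongr; linarith
    linarith
  have h3 := h1.trans (mul_le_mul_of_nonneg_right h2 (sq_nonneg ‖z j‖))
  have h4 := mul_le_mul_of_nonneg_left h3 (show 0 ≤ 2 * l j by positivity)
  have h5 : 2 * l j * (560 * K / n * ‖z j‖ ^ 2) = 1120 * K / n * (l j * ‖z j‖ ^ 2) := by ring
  linarith

theorem bias_le (h : IsGoodDesign z l t H T n K) (hμ : 0 ≤ μ)
    (hq : ∀ j, gramOp z l Finset.univ μ (q j) = z j) :
    ∑ j, t j * ∑ k, l k * ((if k = j then 1 else 0) - √(l k) * √(l j) * ⟪z k, q j⟫_ℝ) ^ 2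
      ≤ 1122 * K ^ 2 * (∑ j ∈ T, l j * t j +
          ((∑ j ∈ T, l j) ^ 2 + μ ^ 2) / n ^ 2 * ∑ j ∈ H, t j / l j) := by
  have hn := h.n_pos
  have hK := h.one_le
  set S := ∑ i ∈ T, l i with hSdef
  rw [← h.union_eq, Finset.sum_union h.disjoint, h.union_eq]
  have hhead : ∑ j ∈ H, t j *
      ∑ k, l k * ((if k = j then 1 else 0) - √(l k) * √(l j) * ⟪z k, q j⟫_ℝ) ^ 2
      ≤ 544 * K ^ 2 * ((S ^ 2 + μ ^ 2) / n ^ 2 * ∑ j ∈ H, t j / l j) := by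
    rw [Finset.mul_sum, Finset.mul_sum]
    refine Finset.sum_le_sum fun j hj => ?_
    refine (mul_le_mul_of_nonneg_left (h.head_bias_le hμ hq hj) (h.nonneg j)).trans (le_of_eq ?_)
    ring
  have htail : ∑ j ∈ T, t j *
      ∑ k, l k * ((if k = j then 1 else 0) - √(l k) * √(l j) * ⟪z k, q j⟫_ℝ) ^ 2
      ≤ 1122 * K ^ 2 * ∑ j ∈ T, l j * t j := by
    calc _ ≤ ∑ j ∈ T, t j * (2 * l j + 1120 * K / n * (l j * ‖z j‖ ^ 2)) :=
          Finset.sum_le_sum fun j _ =>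
            mul_le_mul_of_nonneg_left (h.tail_bias_le hμ hq j) (h.nonneg j)
      _ = 2 * ∑ j ∈ T, l j * t j + 1120 * K / n * ∑ j ∈ T, l j * t j * ‖z j‖ ^ 2 := by
          rw [Finset.mul_sum, Finset.mul_sum, ← Finset.sum_add_distrib]
          exact Finset.sum_congr rfl fun j _ => by ring
      _ ≤ 2 * ∑ j ∈ T, l j * t j + 1120 * K / n * (K * n * ∑ j ∈ T, l j * t j) := by
          gcongr
          exact h.signal_weights
      _ = (2 + 1120 * K ^ 2) * ∑ j ∈ T, l j * t j := by field_simp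
      _ ≤ _ := by
          gcongr
          · exact Finset.sum_nonneg fun j _ => mul_nonneg (h.pos j).le (h.nonneg j)
          · nlinarith
  have h0 : 0 ≤ (S ^ 2 + μ ^ 2) / n ^ 2 * ∑ j ∈ H, t j / l j :=
    mul_nonneg (by positivity) (Finset.sum_nonneg fun j _ => div_nonneg (h.nonneg j) (h.pos j).le)
  have h1 : 0 ≤ K ^ 2 * ((S ^ 2 + μ ^ 2) / n ^ 2 * ∑ j ∈ H, t j / l j) :=
    mul_nonneg (sq_nonneg K) h0
  linarith

theorem noise_le (h : IsGoodDesign z l t H T n K) (hμ : 0 ≤ μ)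
    (hq : ∀ j, gramOp z l Finset.univ μ (q j) = z j) :
    ∑ j, l j ^ 2 * ‖q j‖ ^ 2
      ≤ 256 * K * (H.card / n + n * (∑ j ∈ T, l j ^ 2) / (∑ j ∈ T, l j + μ) ^ 2) := by
  have hs := h.isSpiked hμ
  have hn := h.n_pos
  have hS := h.trace_pos
  have hK := h.one_le
  set S := ∑ i ∈ T, l i with hSdef
  have hqj : ∀ j, gramOp z l (H ∪ T) μ (q j) = z j := by rw [h.union_eq]; exact hq
  rw [← h.union_eq, Finset.sum_union h.disjoint, mul_add]
  refine add_le_add ?_ ?_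
  · calc ∑ j ∈ H, l j ^ 2 * ‖q j‖ ^ 2 ≤ ∑ _j ∈ H, 256 * K / n := by
          refine Finset.sum_le_sum fun j hj => (hs.head_norm_sq_le hj (hqj j)).trans (le_of_eq ?_)
          field_simp
          norm_num
      _ = _ := by rw [Finset.sum_const, nsmul_eq_mul]; ring
  · calc ∑ j ∈ T, l j ^ 2 * ‖q j‖ ^ 2
        ≤ ∑ j ∈ T, l j ^ 2 * (‖z j‖ ^ 2 / ((S + μ) / 16) ^ 2) :=
          Finset.sum_le_sum fun j _ =>
            mul_le_mul_of_nonneg_left (hs.norm_sq_solution_le (hqj j)) (sq_nonneg _)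
      _ = 256 / (S + μ) ^ 2 * ∑ j ∈ T, l j ^ 2 * ‖z j‖ ^ 2 := by
          rw [Finset.mul_sum]
          refine Finset.sum_congr rfl fun j _ => ?_
          field_simp
          norm_num
      _ ≤ 256 / (S + μ) ^ 2 * (K * n * ∑ j ∈ T, l j ^ 2) := by
          gcongr
          exact h.noise_weights
      _ = _ := by ring

theorem risk_le (h : IsGoodDesign z l t H T n K) (hμ : 0 ≤ μ)
    (hq : ∀ j, gramOp z l Finset.univ μ (q j) = z j) {v : ℝ} (hv : 0 ≤ v) :
    ∑ j, t j * ∑ k, l k * ((if k = j then 1 else 0) - √(l k) * √(l j) * ⟪z k, q j⟫_ℝ) ^ 2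
        + v * ∑ j, l j ^ 2 * ‖q j‖ ^ 2
      ≤ 1122 * K ^ 2 * (∑ j ∈ T, l j * t j +
          ((∑ j ∈ T, l j) ^ 2 + μ ^ 2) / n ^ 2 * ∑ j ∈ H, t j / l j +
          v * (H.card / n + n * (∑ j ∈ T, l j ^ 2) / (∑ j ∈ T, l j + μ) ^ 2)) := by
  have hn := h.n_pos
  have hK := h.one_le
  have h1 := h.bias_le hμ hq
  have h2 := mul_le_mul_of_nonneg_left (h.noise_le hμ hq) hv
  have h3 : 0 ≤ v * (H.card / n + n * (∑ j ∈ T, l j ^ 2) / (∑ j ∈ T, l j + μ) ^ 2) := by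
    have : 0 ≤ ∑ j ∈ T, l j ^ 2 := Finset.sum_nonneg fun j _ => sq_nonneg _
    positivity
  have h4 : 256 * K ≤ 1122 * K ^ 2 := by nlinarith
  have h5 := mul_le_mul_of_nonneg_right h4 h3
  linarith

theorem sq_inner_div_le_norm_sq {y p : F} {A : ℝ} (hA : 0 < A) (hy : ‖y‖ ^ 2 ≤ A) :
    ⟪y, p⟫_ℝ ^ 2 / A ≤ ‖p‖ ^ 2 := by
  rw [div_le_iff₀ hA]
  have h1 : ⟪y, p⟫_ℝ ^ 2 ≤ (‖y‖ * ‖p‖) ^ 2 := sq_le_sq' (by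
    linarith [neg_le_of_abs_le (abs_real_inner_le_norm y p)]) (real_inner_le_norm y p)
  nlinarith [mul_le_mul_of_nonneg_right hy (sq_nonneg ‖p‖)]

/-- `κ / (4 d₂) = n / (64 K (S + μ))`; squaring gives the factor `4096 = 64²`. -/
theorem head_leverage_ge (h : IsGoodDesign z l t H T n K) (hμ : 0 ≤ μ)
    (hq : ∀ j, gramOp z l Finset.univ μ (q j) = z j) {j : ι} (hj : j ∈ H) :
    1 / (4096 * K ^ 2) * (n * min (1 / n) (n * l j ^ 2 / (∑ i ∈ T, l i + μ) ^ 2))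
      ≤ l j ^ 2 * ⟪z j, q j⟫_ℝ ^ 2 := by
  have hs := h.isSpiked hμ
  have hn := h.n_pos
  have hS := h.trace_pos
  have hK := h.one_le
  have hlj := h.pos j
  set S := ∑ i ∈ T, l i with hSdef
  have hqj : gramOp z l (H ∪ T) μ (q j) = z j := by rw [h.union_eq]; exact hq j
  have h1 := hs.diag_ge_of_mem_head hj hqj
  have h2 : min (1 / 2) (n * l j / (64 * K * (S + μ))) ≤ l j * ⟪z j, q j⟫_ℝ := by
    have := mul_le_mul_of_nonneg_left h1 hlj.le
    rw [mul_min_of_nonneg _ _ hlj.le] at this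
    refine le_trans (le_of_eq ?_) this
    congr 1
    · field_simp
    · field_simp; norm_num
  rw [← mul_pow]
  refine le_trans ?_ (pow_le_pow_left₀ (by positivity) h2 2)
  rcases min_cases (1 / 2) (n * l j / (64 * K * (S + μ))) with ⟨he, -⟩ | ⟨he, -⟩ <;> rw [he]
  · calc _ ≤ 1 / (4096 * K ^ 2) * (n * (1 / n)) := by gcongr; exact min_le_left _ _
      _ = 1 / (4096 * K ^ 2) := by field_simp
      _ ≤ _ := by
          rw [div_le_iff₀ (by positivity)]
          nlinarith
  · calc _ ≤ 1 / (4096 * K ^ 2) * (n * (n * l j ^ 2 / (S + μ) ^ 2)) := by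
          gcongr; exact min_le_right _ _
      _ = _ := by field_simp; norm_num

theorem tail_leverage_ge (h : IsGoodDesign z l t H T n K) (hμ : 0 ≤ μ)
    (hq : ∀ j, gramOp z l Finset.univ μ (q j) = z j) {j : ι} (hj : j ∈ T)
    (hins : ∀ a : ι → ℝ, n / 16 * ∑ i ∈ insert j H, a i ^ 2 ≤ ‖∑ i ∈ insert j H, a i • z i‖ ^ 2) :
    1 / (512 * K ^ 2) * (n ^ 2 / ((∑ i ∈ T, l i) ^ 2 + μ ^ 2)) ≤ ⟪z j, q j⟫_ℝ ^ 2 := by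
  have hs := h.isSpiked hμ
  have hn := h.n_pos
  have hS := h.trace_pos
  have hK := h.one_le
  set S := ∑ i ∈ T, l i with hSdef
  have hqj : gramOp z l (H ∪ T) μ (q j) = z j := by rw [h.union_eq]; exact hq j
  have h1 := hs.diag_ge_of_notMem_head (fun h' => Finset.disjoint_left.1 h.disjoint h' hj) hins hqj
  refine le_trans ?_ (pow_le_pow_left₀ (by positivity) h1 2)
  have h2 : (n / 16 / (K * (S + μ))) ^ 2 = 1 / (512 * K ^ 2) * (n ^ 2 / ((S + μ) ^ 2 / 2)) := by
    field_simp; norm_num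
  rw [h2]
  gcongr
  nlinarith [sq_nonneg (S - μ)]

/-- In the signal part only the terms `k = j` are kept. In the noise part `‖q_j‖² ≥ ⟪z_j, q_j⟫² /
‖z_j‖²` with `‖z_j‖² ≤ K n`, which costs the third power of `K`. In the tail, the sums run only over
the good indices, which carry half of each weight. -/
theorem le_norm (h : IsGoodDesign z l t H T n K) (hμ : 0 ≤ μ)
    (hq : ∀ j, gramOp z l Finset.univ μ (q j) = z j) {v : ℝ} (hv : 0 ≤ v) :
    1 / (4096 * K ^ 3) * ((∑ j ∈ H, (v / l j + n * t j) *
          min (1 / n) (n * l j ^ 2 / (∑ i ∈ T, l i + μ) ^ 2))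
        + (n * v * ∑ i ∈ T, l i + n ^ 2 * ∑ j ∈ T, t j * l j ^ 2) /
          ((∑ i ∈ T, l i) ^ 2 + μ ^ 2))
      ≤ ∑ j, t j * ∑ k, l k * l j * ⟪z k, q j⟫_ℝ ^ 2 + v * ∑ j, l j * ‖q j‖ ^ 2 := by
  have hn := h.n_pos
  have hS := h.trace_pos
  have hK := h.one_le
  set S := ∑ i ∈ T, l i with hSdef
  obtain ⟨G, hGT, hG, hG₁, hG₂⟩ := h.exists_good
  have hterm : ∀ j, t j * (l j ^ 2 * ⟪z j, q j⟫_ℝ ^ 2)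
      ≤ t j * ∑ k, l k * l j * ⟪z k, q j⟫_ℝ ^ 2 := fun j => by
    refine mul_le_mul_of_nonneg_left ?_ (h.nonneg j)
    have := Finset.single_le_sum (s := Finset.univ) (f := fun k => l k * l j * ⟪z k, q j⟫_ℝ ^ 2)
      (fun k _ => mul_nonneg (mul_nonneg (h.pos k).le (h.pos j).le) (sq_nonneg _))
      (Finset.mem_univ j)
    simpa [pow_two] using this
  have hall : ∑ j ∈ H ∪ G, (t j * (l j ^ 2 * ⟪z j, q j⟫_ℝ ^ 2) + v * (l j * ‖q j‖ ^ 2))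
      ≤ ∑ j, t j * ∑ k, l k * l j * ⟪z k, q j⟫_ℝ ^ 2 + v * ∑ j, l j * ‖q j‖ ^ 2 := by
    rw [Finset.mul_sum, ← Finset.sum_add_distrib]
    refine (Finset.sum_le_sum fun j _ => add_le_add_left (hterm j) _).trans
      (Finset.sum_le_sum_of_subset_of_nonneg (Finset.subset_univ _) fun j _ _ => ?_)
    have h1 : 0 ≤ t j * (l j ^ 2 * ⟪z j, q j⟫_ℝ ^ 2) := mul_nonneg (h.nonneg j) (by positivity)
    have h2 : 0 ≤ v * (l j * ‖q j‖ ^ 2) := by have := h.pos j; positivity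
    linarith [hterm j]
  refine le_trans ?_ hall
  rw [Finset.sum_union (h.disjoint.mono_right hGT), mul_add]
  refine add_le_add ?_ ?_
  · rw [Finset.mul_sum]
    refine Finset.sum_le_sum fun j hj => ?_
    have hlj := h.pos j
    have htj := h.nonneg j
    have h1 := h.head_leverage_ge hμ hq hj
    have h2 := sq_inner_div_le_norm_sq (p := q j) (by positivity) (h.head_norm j hj)
    set x := min (1 / n) (n * l j ^ 2 / (S + μ) ^ 2)
    have hx : 0 ≤ x := by positivity
    have h3 : 1 / (4096 * K ^ 3) * (n * t j * x) ≤ t j * (l j ^ 2 * ⟪z j, q j⟫_ℝ ^ 2) := by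
      calc 1 / (4096 * K ^ 3) * (n * t j * x) ≤ 1 / (4096 * K ^ 2) * (n * t j * x) := by
            gcongr
            norm_num
        _ = t j * (1 / (4096 * K ^ 2) * (n * x)) := by ring
        _ ≤ _ := mul_le_mul_of_nonneg_left h1 htj
    have h4 : 1 / (4096 * K ^ 3) * (v / l j * x) ≤ v * (l j * ‖q j‖ ^ 2) := by
      calc 1 / (4096 * K ^ 3) * (v / l j * x)
          = v * (1 / (l j * (K * n)) * (1 / (4096 * K ^ 2) * (n * x))) := by field_simp
        _ ≤ v * (1 / (l j * (K * n)) * (l j ^ 2 * ⟪z j, q j⟫_ℝ ^ 2)) := by gcongr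
        _ = v * (l j * (⟪z j, q j⟫_ℝ ^ 2 / (K * n))) := by field_simp
        _ ≤ _ := by gcongr
    linarith
  · have hD : 0 < S ^ 2 + μ ^ 2 := by positivity
    rw [Finset.sum_add_distrib]
    have h1 : ∑ j ∈ G, t j * (l j ^ 2 * ⟪z j, q j⟫_ℝ ^ 2)
        ≥ 1 / (512 * K ^ 2) * (n ^ 2 / (S ^ 2 + μ ^ 2)) * ∑ j ∈ G, t j * l j ^ 2 := by
      rw [Finset.mul_sum]
      refine Finset.sum_le_sum fun j hj => ?_
      have h2 := h.tail_leverage_ge hμ hq (hGT hj) (hG j hj).2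
      have h3 := mul_le_mul_of_nonneg_left h2 (mul_nonneg (h.nonneg j) (sq_nonneg (l j)))
      linarith
    have h2 : ∑ j ∈ G, v * (l j * ‖q j‖ ^ 2)
        ≥ 1 / (512 * K ^ 3) * (n * v / (S ^ 2 + μ ^ 2)) * ∑ j ∈ G, l j := by
      rw [Finset.mul_sum]
      refine Finset.sum_le_sum fun j hj => ?_
      have hlj := h.pos j
      have h2 := h.tail_leverage_ge hμ hq (hGT hj) (hG j hj).2
      have h3 := sq_inner_div_le_norm_sq (p := q j) (by positivity) (hG j hj).1
      calc 1 / (512 * K ^ 3) * (n * v / (S ^ 2 + μ ^ 2)) * l j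
          = v * (l j * (1 / (512 * K ^ 2) * (n ^ 2 / (S ^ 2 + μ ^ 2)) / (K * n))) := by
            field_simp
        _ ≤ v * (l j * (⟪z j, q j⟫_ℝ ^ 2 / (K * n))) := by gcongr
        _ ≤ _ := by gcongr
    have hT0 : 0 ≤ ∑ j ∈ T, t j * l j ^ 2 :=
      Finset.sum_nonneg fun j _ => mul_nonneg (h.nonneg j) (sq_nonneg _)
    have h3 : 1 / (4096 * K ^ 3) * (n ^ 2 / (S ^ 2 + μ ^ 2) * ∑ j ∈ T, t j * l j ^ 2)
        ≤ 1 / (512 * K ^ 2) * (n ^ 2 / (S ^ 2 + μ ^ 2)) * ∑ j ∈ G, t j * l j ^ 2 := by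
      calc _ ≤ 1 / (1024 * K ^ 2) * (n ^ 2 / (S ^ 2 + μ ^ 2) * ∑ j ∈ T, t j * l j ^ 2) := by
            gcongr ?_ * _
            gcongr 1 / (?_ * ?_)
            · norm_num
            · gcongr
              norm_num
        _ = 1 / (512 * K ^ 2) * (n ^ 2 / (S ^ 2 + μ ^ 2)) * ((∑ j ∈ T, t j * l j ^ 2) / 2) := by
            ring
        _ ≤ _ := by gcongr
    have h4 : 1 / (4096 * K ^ 3) * (n * v / (S ^ 2 + μ ^ 2) * S)
        ≤ 1 / (512 * K ^ 3) * (n * v / (S ^ 2 + μ ^ 2)) * ∑ j ∈ G, l j := by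
      calc _ ≤ 1 / (1024 * K ^ 3) * (n * v / (S ^ 2 + μ ^ 2) * S) := by
            gcongr ?_ * _
            gcongr 1 / (?_ * _)
            norm_num
        _ = 1 / (512 * K ^ 3) * (n * v / (S ^ 2 + μ ^ 2)) * (S / 2) := by ring
        _ ≤ _ := by gcongr
    have h5 : 1 / (4096 * K ^ 3) *
        ((n * v * S + n ^ 2 * ∑ j ∈ T, t j * l j ^ 2) / (S ^ 2 + μ ^ 2))
        = 1 / (4096 * K ^ 3) * (n ^ 2 / (S ^ 2 + μ ^ 2) * ∑ j ∈ T, t j * l j ^ 2)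
          + 1 / (4096 * K ^ 3) * (n * v / (S ^ 2 + μ ^ 2) * S) := by ring
    linarith

end IsGoodDesign

end GoodDesign

/-! ### Exact formulas for the risk and the norm of the ridge estimator -/

section SecondMoments

variable {Ω : Type*} [MeasurableSpace Ω] {μ : Measure Ω} [IsProbabilityMeasure μ]

theorem integral_sub_const_sq {f : Ω → ℝ} (hf : MemLp f 2 μ) (d : ℝ) :
    ∫ ω, (f ω - d) ^ 2 ∂μ = (∫ ω, f ω ∂μ - d) ^ 2 + Var[f; μ] := by
  have h1 : Var[fun ω => f ω - d; μ] = Var[f; μ] := variance_sub_const hf.aestronglyMeasurable d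
  have h2 : MemLp (fun ω => f ω - d) 2 μ := hf.sub (memLp_const d)
  have h3 := variance_eq_sub h2
  rw [h1, integral_sub (hf.integrable (by norm_num)) (integrable_const d)] at h3
  simp only [integral_const, probReal_univ, smul_eq_mul, one_mul, Pi.pow_apply] at h3
  linarith

/-- Bias-variance decomposition for a linear functional of independent labels. -/
theorem integral_pi_linear_sub_sq {I : Type*} [Fintype I] {ν : I → Measure ℝ}
    [∀ i, IsProbabilityMeasure (ν i)] (hL : ∀ i, MemLp id 2 (ν i)) {m : I → ℝ}
    (hm : ∀ i, ∫ y, y ∂(ν i) = m i) {v : ℝ} (hv : ∀ i, ∫ y, (y - m i) ^ 2 ∂(ν i) = v)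
    (a : I → ℝ) (d : ℝ) :
    Integrable (fun y : I → ℝ => (∑ i, a i * y i - d) ^ 2) (Measure.pi ν) ∧
    ∫ y : I → ℝ, (∑ i, a i * y i - d) ^ 2 ∂(Measure.pi ν)
      = (∑ i, a i * m i - d) ^ 2 + v * ∑ i, a i ^ 2 := by
  have hLa : ∀ i, MemLp (fun y : ℝ => a i * y) 2 (ν i) := fun i => (hL i).const_mul (a i)
  have hLp : ∀ i, MemLp (fun y : I → ℝ => a i * y i) 2 (Measure.pi ν) := fun i =>
    (hLa i).comp_measurePreserving (measurePreserving_eval ν i)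
  have hsum : MemLp (fun y : I → ℝ => ∑ i, a i * y i) 2 (Measure.pi ν) :=
    memLp_finsetSum _ fun i _ => hLp i
  refine ⟨(hsum.sub (memLp_const d)).integrable_sq, ?_⟩
  rw [integral_sub_const_sq hsum]
  congr 1
  · rw [integral_finsetSum _ fun i _ => (hLp i).integrable (by norm_num)]
    have hcoord : ∀ i, ∫ y : I → ℝ, a i * y i ∂(Measure.pi ν) = a i * m i := fun i => by
      rw [integral_const_mul, ← hm i]
      congr 1
      exact integral_comp_eval (i := i) (μ := ν) (f := fun y : ℝ => y) (hL i).aestronglyMeasurable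
    simp only [hcoord]
  · have h1 := variance_sum_pi (μ := ν) (X := fun i y => a i * y) hLa
    have h2 : (∑ i, fun y : I → ℝ => a i * y i) = fun y : I → ℝ => ∑ i, a i * y i := by
      ext y; simp
    rw [h2] at h1
    rw [h1, Finset.mul_sum]
    refine Finset.sum_congr rfl fun i _ => ?_
    rw [variance_const_mul, variance_eq_integral aemeasurable_id']
    simp only [hm i, hv i]
    ring

end SecondMoments

/-! ### Averages over independent uniform signs -/

section Signs

/-- Flipping the `i`-th sign is a fixed-point-free involution that negates the summand. -/
theorem sum_signs_mul_eq_zero {J : Type*} [Fintype J] [DecidableEq J] {i j : J} (hij : i ≠ j) :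
    ∑ s : J → ℤˣ, (((s i : ℤ) : ℝ) * ((s j : ℤ) : ℝ)) = 0 := by
  refine Finset.sum_involution (fun s _ => Function.update s i (-s i)) ?_ ?_ ?_ ?_
  · intro s _
    simp [Function.update_of_ne hij.symm]
  · intro s _ hs h
    have := congrFun h i
    simp only [Function.update_self] at this
    exact (units_ne_neg_self (s i)) this.symm
  · intro s _; exact Finset.mem_univ _
  · intro s _; simp

theorem expect_signs_sum_sq {J : Type*} [Fintype J] [DecidableEq J] (a : J → ℝ) :
    𝔼 s : J → ℤˣ, (∑ j, ((s j : ℤ) : ℝ) * a j) ^ 2 = ∑ j, a j ^ 2 := by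
  have h1 : ∀ s : J → ℤˣ, (∑ j, ((s j : ℤ) : ℝ) * a j) ^ 2
      = ∑ i, ∑ j, a i * a j * (((s i : ℤ) : ℝ) * ((s j : ℤ) : ℝ)) := fun s => by
    rw [pow_two, Finset.sum_mul_sum]
    exact Finset.sum_congr rfl fun i _ => Finset.sum_congr rfl fun j _ => by ring
  simp only [h1]
  rw [Finset.expect_sum_comm]
  refine Finset.sum_congr rfl fun i _ => ?_
  rw [Finset.expect_sum_comm, Finset.sum_eq_single i]
  · have h2 : ∀ s : J → ℤˣ, a i * a i * (((s i : ℤ) : ℝ) * ((s i : ℤ) : ℝ)) = a i ^ 2 := fun s => by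
      rcases Int.units_eq_one_or (s i) with h | h <;> simp [h, pow_two]
    simp [h2]
  · intro j _ hj
    rw [← Finset.mul_expect, Finset.expect, sum_signs_mul_eq_zero hj.symm]
    simp
  · simp

end Signs

/-! ### The ridge estimator in the eigenbasis -/

theorem mpInverse_eq_inv {n : Type*} [Fintype n] [DecidableEq n] {A : Matrix n n ℝ}
    (hA : IsUnit A.det) : mpInverse A = A⁻¹ := by
  have h : IsMoorePenrose A A⁻¹ := by
    constructor <;> simp [Matrix.mul_nonsing_inv A hA, Matrix.nonsing_inv_mul A hA]
  have hex : ∃ B, IsMoorePenrose A B := ⟨_, h⟩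
  rw [mpInverse, dif_pos hex]
  exact hex.choose_spec.unique h

namespace RegressionModel

variable {σx : ℝ} (M : RegressionModel σx) {n : ℕ}

/-- The `j`-th normalized feature column: the `j`-th components of `η` for the `n` covariates. -/
noncomputable def featureCol (X : Fin n → EuclideanSpace ℝ (Fin M.p)) (j : Fin M.p) :
    EuclideanSpace ℝ (Fin n) :=
  WithLp.toLp 2 fun i => ⟪M.eigvec j, X i⟫_ℝ / √(M.eigval j)

theorem sqrt_mul_featureCol (X : Fin n → EuclideanSpace ℝ (Fin M.p)) (j : Fin M.p) (i : Fin n) :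
    √(M.eigval j) * M.featureCol X j i = ⟪M.eigvec j, X i⟫_ℝ := by
  have := Real.sqrt_pos.2 (M.eigval_pos j)
  simp only [featureCol]
  field_simp

theorem gramMatrix_mulVec (X : Fin n → EuclideanSpace ℝ (Fin M.p)) (μ : ℝ) (u : Fin n → ℝ) :
    WithLp.toLp 2 (((Matrix.of fun i j => X i j) * (Matrix.of fun i j => X i j)ᵀ
        + μ • (1 : Matrix (Fin n) (Fin n) ℝ)) *ᵥ u)
      = gramOp (M.featureCol X) M.eigval Finset.univ μ (WithLp.toLp 2 u) := by
  ext i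
  rw [gramOp_apply]
  simp only [Matrix.add_mulVec, Matrix.smul_mulVec, Matrix.one_mulVec, PiLp.add_apply,
    PiLp.smul_apply, WithLp.ofLp_sum, Finset.sum_apply, smul_eq_mul, Pi.add_apply, Pi.smul_apply]
  congr 1
  have h1 : ∀ k, ((Matrix.of fun i j => X i j) * (Matrix.of fun i j => X i j)ᵀ) i k
      = ∑ j, M.eigval j * M.featureCol X j i * M.featureCol X j k := by
    intro k
    have e1 : ((Matrix.of fun i j => X i j) * (Matrix.of fun i j => X i j)ᵀ) i k
        = ⟪X i, X k⟫_ℝ := by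
      simp [Matrix.mul_apply, PiLp.inner_apply, mul_comm]
    rw [e1, ← M.eigvec.sum_inner_mul_inner]
    refine Finset.sum_congr rfl fun j _ => ?_
    rw [real_inner_comm, ← M.sqrt_mul_featureCol X j i, ← M.sqrt_mul_featureCol X j k]
    have := Real.mul_self_sqrt (M.eigval_pos j).le
    linear_combination (M.featureCol X j i * M.featureCol X j k) * this
  simp only [Matrix.mulVec, dotProduct, h1]
  simp only [Finset.sum_mul]
  rw [Finset.sum_comm]
  refine Finset.sum_congr rfl fun j _ => ?_
  simp only [PiLp.inner_apply, Finset.mul_sum, Finset.sum_mul]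
  refine Finset.sum_congr rfl fun k _ => ?_
  simp
  ring

/-- An injective Gram matrix is invertible, so the pseudoinverse is the inverse, also at `lam = 0`.
Symmetry of the inverse moves it from `y` to the feature column. -/
theorem exists_inner_ridge_eq (X : Fin n → EuclideanSpace ℝ (Fin M.p)) (lam : ℝ)
    (hpos : ∀ u, u ≠ 0 →
      gramOp (M.featureCol X) M.eigval Finset.univ (n * lam) u ≠ 0) :
    ∃ q : Fin M.p → EuclideanSpace ℝ (Fin n),
      (∀ j, gramOp (M.featureCol X) M.eigval Finset.univ (n * lam) (q j) = M.featureCol X j) ∧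
      ∀ y j, ⟪M.eigvec j, ridge X lam y⟫_ℝ = √(M.eigval j) * ∑ i, q j i * y i := by
  set A : Matrix (Fin n) (Fin n) ℝ := (Matrix.of fun i j => X i j) * (Matrix.of fun i j => X i j)ᵀ
        + ((n : ℝ) * lam) • (1 : Matrix (Fin n) (Fin n) ℝ) with hA
  have hdet : IsUnit A.det := by
    rw [← Matrix.isUnit_iff_isUnit_det, ← Matrix.mulVec_injective_iff_isUnit]
    intro u v huv
    by_contra hne
    apply hpos (WithLp.toLp 2 (u - v))
    · simpa [sub_eq_zero] using hne
    · rw [← M.gramMatrix_mulVec, ← hA, Matrix.mulVec_sub]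
      simpa [sub_eq_zero] using huv
  have hinv : ∀ y : Fin n → ℝ, gramOp (M.featureCol X) M.eigval Finset.univ (n * lam)
      (WithLp.toLp 2 (A⁻¹ *ᵥ y)) = WithLp.toLp 2 y := fun y => by
    rw [← M.gramMatrix_mulVec, ← hA, Matrix.mulVec_mulVec, Matrix.mul_nonsing_inv A hdet,
      Matrix.one_mulVec]
  refine ⟨fun j => WithLp.toLp 2 (A⁻¹ *ᵥ (M.featureCol X j).ofLp), fun j => hinv _, fun y j => ?_⟩
  set w := A⁻¹ *ᵥ y with hw
  have hridge : ridge X lam y = ∑ i, w i • X i := by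
    simp only [ridge]
    rw [← hA, mpInverse_eq_inv hdet, ← hw]
    ext k
    simp [Matrix.mulVec, dotProduct, mul_comm]
  rw [hridge, inner_sum]
  calc ∑ i, ⟪M.eigvec j, w i • X i⟫_ℝ
      = √(M.eigval j) * ⟪M.featureCol X j, WithLp.toLp 2 w⟫_ℝ := by
        rw [PiLp.inner_apply, Finset.mul_sum]
        refine Finset.sum_congr rfl fun i _ => ?_
        rw [real_inner_smul_right, ← M.sqrt_mul_featureCol X j i]
        simp
        ring
    _ = √(M.eigval j) * ⟪WithLp.toLp 2 (A⁻¹ *ᵥ (M.featureCol X j).ofLp), WithLp.toLp 2 y⟫_ℝ := by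
        congr 1
        conv_lhs => rw [show M.featureCol X j = WithLp.toLp 2 (M.featureCol X j).ofLp from rfl,
          ← hinv (M.featureCol X j).ofLp]
        rw [← inner_gramOp_comm, hinv]
    _ = _ := by
        rw [PiLp.inner_apply]
        congr 1
        refine Finset.sum_congr rfl fun i _ => ?_
        simp [mul_comm]

/-! ### Risk and squared norm -/

/-- At the covariates `X`, the conditional laws of the labels have the prescribed moments. -/
def HasLabelMoments (X : Fin n → EuclideanSpace ℝ (Fin M.p)) : Prop :=
  ∀ s i, MemLp id 2 (M.label s (X i)) ∧ ∫ y, y ∂(M.label s (X i)) = ⟪X i, M.param s⟫_ℝ ∧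
    ∫ y, (y - ⟪X i, M.param s⟫_ℝ) ^ 2 ∂(M.label s (X i)) = M.noiseVar

instance : IsProbabilityMeasure M.law := M.isProb

instance (n : ℕ) : IsProbabilityMeasure (M.designLaw n) := by
  unfold designLaw; infer_instance

theorem ae_hasLabelMoments : ∀ᵐ X ∂(M.designLaw n), M.HasLabelMoments X := by
  simp only [HasLabelMoments]
  refine ae_all_iff.2 fun s => ae_all_iff.2 fun i => ?_
  have h : ∀ᵐ x ∂M.law, MemLp id 2 (M.label s x) ∧ ∫ y, y ∂(M.label s x) = ⟪x, M.param s⟫_ℝ ∧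
      ∫ y, (y - ⟪x, M.param s⟫_ℝ) ^ 2 ∂(M.label s x) = M.noiseVar := by
    filter_upwards [M.label_memLp s, M.label_mean s, M.label_var s] with x h1 h2 h3
    exact ⟨h1, h2, h3⟩
  exact (measurePreserving_eval (fun _ : Fin n => M.law) i).quasiMeasurePreserving.ae h

theorem inner_eigvec_param (s : Fin M.p → ℤˣ) (j : Fin M.p) :
    ⟪M.eigvec j, M.param s⟫_ℝ = ((s j : ℤ) : ℝ) * M.coef j := by
  rw [param, signFlip, inner_sum, Finset.sum_eq_single j, real_inner_smul_right]
  · rw [real_inner_self_eq_norm_sq, M.eigvec.orthonormal.1 j, one_pow, mul_one, coef]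
  · intro k _ hk
    rw [real_inner_smul_right, orthonormal_iff_ite.1 M.eigvec.orthonormal, if_neg hk.symm, mul_zero]
  · exact fun h => absurd (Finset.mem_univ j) h

theorem integral_inner_sub_sq (e θ : EuclideanSpace ℝ (Fin M.p)) :
    ∫ x, (⟪x, e⟫_ℝ - ⟪x, θ⟫_ℝ) ^ 2 ∂M.law
      = ∑ j, M.eigval j * (⟪M.eigvec j, e⟫_ℝ - ⟪M.eigvec j, θ⟫_ℝ) ^ 2 := by
  have h1 : ∀ x, ⟪x, e⟫_ℝ - ⟪x, θ⟫_ℝ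
      = ∑ j, √(M.eigval j) * (⟪M.eigvec j, e⟫_ℝ - ⟪M.eigvec j, θ⟫_ℝ) *
        (⟪M.eigvec j, x⟫_ℝ / √(M.eigval j)) := fun x => by
    rw [← inner_sub_right, ← M.eigvec.sum_inner_mul_inner]
    refine Finset.sum_congr rfl fun j _ => ?_
    have := Real.sqrt_pos.2 (M.eigval_pos j)
    rw [inner_sub_right, real_inner_comm]
    field_simp
  rw [integral_congr_ae (ae_of_all _ fun x => congrArg (· ^ 2) (h1 x))]
  rw [M.indep.integral_sum_mul_sq (fun j => (M.subgaussian j).memLp 2) M.mean_zero M.unit_var]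
  exact Finset.sum_congr rfl fun j _ => by rw [mul_pow, Real.sq_sqrt (M.eigval_pos j).le]

variable {M} {X : Fin n → EuclideanSpace ℝ (Fin M.p)} {lam : ℝ}
  {q : Fin M.p → EuclideanSpace ℝ (Fin n)}

theorem integral_labelLaw_sq (hX : M.HasLabelMoments X) (s : Fin M.p → ℤˣ)
    (w : EuclideanSpace ℝ (Fin n)) (r d : ℝ) :
    Integrable (fun y : Fin n → ℝ => (r * ∑ i, w i * y i - d) ^ 2) (M.labelLaw s X) ∧
    ∫ y : Fin n → ℝ, (r * ∑ i, w i * y i - d) ^ 2 ∂(M.labelLaw s X)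
      = (∑ j, ((s j : ℤ) : ℝ) * (M.coef j * (r * √(M.eigval j) * ⟪M.featureCol X j, w⟫_ℝ)) - d) ^ 2
        + M.noiseVar * (r ^ 2 * ‖w‖ ^ 2) := by
  have := M.label_markov s
  have h := integral_pi_linear_sub_sq (ν := fun i => M.label s (X i)) (fun i => (hX s i).1)
    (fun i => (hX s i).2.1) (fun i => (hX s i).2.2) (fun i => r * w i) d
  have h1 : ∑ i, r * w i * ⟪X i, M.param s⟫_ℝ
      = ∑ j, ((s j : ℤ) : ℝ) * (M.coef j * (r * √(M.eigval j) * ⟪M.featureCol X j, w⟫_ℝ)) := by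
    have e1 : ∀ i, ⟪X i, M.param s⟫_ℝ
        = ∑ j, √(M.eigval j) * M.featureCol X j i * (((s j : ℤ) : ℝ) * M.coef j) := fun i => by
      rw [← M.eigvec.sum_inner_mul_inner]
      refine Finset.sum_congr rfl fun j _ => ?_
      rw [M.inner_eigvec_param, M.sqrt_mul_featureCol, real_inner_comm]
    simp only [e1, Finset.mul_sum, PiLp.inner_apply]
    rw [Finset.sum_comm]
    refine Finset.sum_congr rfl fun j _ => Finset.sum_congr rfl fun i _ => ?_
    simp
    ring
  have h2 : ∑ i, (r * w i) ^ 2 = r ^ 2 * ‖w‖ ^ 2 := by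
    rw [EuclideanSpace.norm_sq_eq, Finset.mul_sum]
    exact Finset.sum_congr rfl fun i _ => by simp [mul_pow]
  simp only [mul_assoc r, ← Finset.mul_sum] at h
  rw [h2] at h
  simp only [mul_assoc r, ← Finset.mul_sum] at h1
  rw [h1] at h
  simpa only [labelLaw, mul_assoc] using h

/-- Given the signs, each coordinate error is a signed sum over `j` plus noise. Averaging the signs
removes the cross terms, and symmetry of the resolvent allows the answer to be indexed by `q j`. -/
theorem stdRisk_ridge_eq (hX : M.HasLabelMoments X)
    (hq : ∀ j, gramOp (M.featureCol X) M.eigval Finset.univ (n * lam) (q j) = M.featureCol X j)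
    (hr : ∀ y j, ⟪M.eigvec j, ridge X lam y⟫_ℝ = √(M.eigval j) * ∑ i, q j i * y i) :
    M.stdRisk X (ridge X lam)
      = ∑ j, M.coef j ^ 2 * ∑ k, M.eigval k * ((if k = j then 1 else 0)
          - √(M.eigval k) * √(M.eigval j) * ⟪M.featureCol X k, q j⟫_ℝ) ^ 2
        + M.noiseVar * ∑ j, M.eigval j ^ 2 * ‖q j‖ ^ 2 := by
  have hsymm : ∀ j k, ⟪M.featureCol X j, q k⟫_ℝ = ⟪M.featureCol X k, q j⟫_ℝ := fun j k => by
    conv_lhs => rw [← hq j]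
    rw [← inner_gramOp_comm, hq k, real_inner_comm]
  have h1 : ∀ s, ∫ y, (∫ x, (⟪x, ridge X lam y⟫_ℝ - ⟪x, M.param s⟫_ℝ) ^ 2 ∂M.law)
      ∂(M.labelLaw s X) = ∑ k, M.eigval k *
        ((∑ j, ((s j : ℤ) : ℝ) * (M.coef j * (√(M.eigval k) * √(M.eigval j) *
            ⟪M.featureCol X k, q j⟫_ℝ - if k = j then 1 else 0))) ^ 2
          + M.noiseVar * (M.eigval k * ‖q k‖ ^ 2)) := fun s => by
    simp only [M.integral_inner_sub_sq, hr, M.inner_eigvec_param]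
    rw [integral_finsetSum _ fun k _ =>
      ((integral_labelLaw_sq hX s (q k) _ _).1.const_mul (M.eigval k))]
    refine Finset.sum_congr rfl fun k _ => ?_
    rw [integral_const_mul, (integral_labelLaw_sq hX s (q k) _ _).2,
      Real.sq_sqrt (M.eigval_pos k).le]
    congr 4
    simp only [hsymm _ k, mul_sub, Finset.sum_sub_distrib]
    simp
  simp only [stdRisk, h1]
  rw [Finset.expect_sum_comm]
  simp only [← Finset.mul_expect, Finset.expect_add_distrib, expect_signs_sum_sq]
  simp only [Finset.expect_const Finset.univ_nonempty, mul_add, Finset.sum_add_distrib]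
  congr 1
  · simp only [Finset.mul_sum]
    rw [Finset.sum_comm]
    exact Finset.sum_congr rfl fun j _ => Finset.sum_congr rfl fun k _ => by ring
  · rw [Finset.mul_sum]
    exact Finset.sum_congr rfl fun j _ => by ring

theorem sqNorm_ridge_eq (hX : M.HasLabelMoments X)
    (hq : ∀ j, gramOp (M.featureCol X) M.eigval Finset.univ (n * lam) (q j) = M.featureCol X j)
    (hr : ∀ y j, ⟪M.eigvec j, ridge X lam y⟫_ℝ = √(M.eigval j) * ∑ i, q j i * y i) :
    M.sqNorm X (ridge X lam)
      = ∑ j, M.coef j ^ 2 * ∑ k, M.eigval k * M.eigval j * ⟪M.featureCol X k, q j⟫_ℝ ^ 2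
        + M.noiseVar * ∑ j, M.eigval j * ‖q j‖ ^ 2 := by
  have hsymm : ∀ j k, ⟪M.featureCol X j, q k⟫_ℝ = ⟪M.featureCol X k, q j⟫_ℝ := fun j k => by
    conv_lhs => rw [← hq j]
    rw [← inner_gramOp_comm, hq k, real_inner_comm]
  have h1 : ∀ s, ∫ y, ‖ridge X lam y‖ ^ 2 ∂(M.labelLaw s X) = ∑ k,
        ((∑ j, ((s j : ℤ) : ℝ) * (M.coef j * (√(M.eigval k) * √(M.eigval j) *
            ⟪M.featureCol X k, q j⟫_ℝ))) ^ 2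
          + M.noiseVar * (M.eigval k * ‖q k‖ ^ 2)) := fun s => by
    have hn : ∀ y, ‖ridge X lam y‖ ^ 2
        = ∑ k, (√(M.eigval k) * ∑ i, q k i * y i - 0) ^ 2 := fun y => by
      rw [← M.eigvec.sum_sq_inner_right]
      exact Finset.sum_congr rfl fun k _ => by rw [hr, sub_zero]
    simp only [hn]
    rw [integral_finsetSum _ fun k _ => (integral_labelLaw_sq hX s (q k) _ _).1]
    refine Finset.sum_congr rfl fun k _ => ?_
    rw [(integral_labelLaw_sq hX s (q k) _ _).2, Real.sq_sqrt (M.eigval_pos k).le, sub_zero]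
    simp only [hsymm _ k]
  simp only [sqNorm, h1]
  rw [Finset.expect_sum_comm]
  simp only [Finset.expect_add_distrib, expect_signs_sum_sq]
  simp only [Finset.expect_const Finset.univ_nonempty, Finset.sum_add_distrib]
  congr 1
  · simp only [Finset.mul_sum]
    rw [Finset.sum_comm]
    refine Finset.sum_congr rfl fun j _ => Finset.sum_congr rfl fun k _ => ?_
    rw [mul_pow, mul_pow, mul_pow, Real.sq_sqrt (M.eigval_pos k).le,
      Real.sq_sqrt (M.eigval_pos j).le]
  · rw [Finset.mul_sum]

end RegressionModel

/-! ### The design is good with overwhelming probability -/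

namespace RegressionModel

variable {σx : ℝ} (M : RegressionModel σx) {n : ℕ}

theorem measurable_featureCol_apply (i : Fin n) (j : Fin M.p) :
    Measurable fun X : Fin n → EuclideanSpace ℝ (Fin M.p) => M.featureCol X j i := by
  simp only [featureCol]
  fun_prop

theorem isSubgaussianArray_featureCol (n : ℕ) :
    IsSubgaussianArray (fun (i : Fin n) (j : Fin M.p) X => M.featureCol X j i)
      (Real.toNNReal (σx ^ 2)) (M.designLaw n) := by
  have hmp : ∀ i, MeasurePreserving (Function.eval i) (M.designLaw n) M.law :=
    measurePreserving_eval (fun _ : Fin n => M.law)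
  have hη : ∀ j, Measurable fun x => ⟪M.eigvec j, x⟫_ℝ / √(M.eigval j) := fun j => by fun_prop
  refine ⟨fun i j => M.measurable_featureCol_apply i j, ?_, fun i j => ?_, fun i j => ?_,
    fun i j => ?_⟩
  · refine iIndepFun_uncurry' (X := fun (i : Fin n) (j : Fin M.p) X => M.featureCol X j i)
      (fun i j => M.measurable_featureCol_apply i j) ?_ fun i => ?_
    · exact iIndepFun_pi (μ := fun _ : Fin n => M.law)
        (X := fun _ x j => ⟪M.eigvec j, x⟫_ℝ / √(M.eigval j))
        fun _ => (measurable_pi_iff.2 hη).aemeasurable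
    · rw [iIndepFun_iff_map_fun_eq_pi_map fun j => (M.measurable_featureCol_apply i j).aemeasurable]
      have h := (iIndepFun_iff_map_fun_eq_pi_map fun j => (hη j).aemeasurable).1 M.indep
      rw [← (hmp i).map_eq, Measure.map_map (measurable_pi_iff.2 hη) (hmp i).measurable] at h
      refine h.trans ?_
      congr 1
      funext j
      rw [Measure.map_map (hη j) (hmp i).measurable]
      rfl
  · have h := M.subgaussian j
    rw [← (hmp i).map_eq] at h
    exact h.of_map (hmp i).measurable.aemeasurable
  · rw [← M.mean_zero j]
    exact integral_comp_eval (μ := fun _ : Fin n => M.law) (i := i)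
      (f := fun x => ⟪M.eigvec j, x⟫_ℝ / √(M.eigval j)) (hη j).aestronglyMeasurable
  · rw [← M.unit_var j]
    exact integral_comp_eval (μ := fun _ : Fin n => M.law) (i := i)
      (f := fun x => (⟪M.eigvec j, x⟫_ℝ / √(M.eigval j)) ^ 2)
      ((hη j).pow_const 2).aestronglyMeasurable

theorem inner_featureCol (X : Fin n → EuclideanSpace ℝ (Fin M.p)) (j : Fin M.p)
    (u : EuclideanSpace ℝ (Fin n)) :
    ⟪M.featureCol X j, u⟫_ℝ = ∑ i, u i * M.featureCol X j i := by
  rw [PiLp.inner_apply]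
  exact Finset.sum_congr rfl fun i _ => by simp

/-- The covariates for which the feature columns with index in `T` fail to be well-conditioned. -/
def illConditioned (n : ℕ) (K : ℝ) (T : Finset (Fin M.p)) :
    Set (Fin n → EuclideanSpace ℝ (Fin M.p)) :=
  {X | ¬ ∀ u : EuclideanSpace ℝ T,
    (∑ _i : Fin n, (1 : ℝ)) / 16 * ‖u‖ ^ 2
      ≤ ∑ i : Fin n, (1 : ℝ) * (∑ j : T, u j * M.featureCol X j i) ^ 2 ∧
    ∑ i : Fin n, (1 : ℝ) * (∑ j : T, u j * M.featureCol X j i) ^ 2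
      ≤ K * (∑ _i : Fin n, (1 : ℝ)) * ‖u‖ ^ 2}

/-- The roles of rows and columns are exchanged: the sphere lies in `ℝ^T` and the `n` rows are
summands of weight one. Of the available `n²`, one half pays for the net and the other half gives `τ
= n / (1280 c²)`. -/
theorem measure_illConditioned_le {c : NNReal} (hcσ : c = Real.toNNReal (σx ^ 2)) (hc : 0 < c)
    (hn : 0 < n) {T : Finset (Fin M.p)} (hT : T.card ≤ n)
    (hT' : 1280 * c ^ 2 * (T.card * Real.log (netBase c)) ≤ n) :
    M.designLaw n (M.illConditioned n (56 * c) T)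
      ≤ ENNReal.ofReal (Real.exp (-n) + Real.exp (-(n / (1280 * c ^ 2)))) := by
  have hc' : (0 : ℝ) < c := hc
  have hn' : (0 : ℝ) < n := by exact_mod_cast hn
  have harr := ((M.isSubgaussianArray_featureCol n).swap.comp
    (e := ((↑) : T → Fin M.p)) (f := (id : Fin n → Fin n)) Subtype.val_injective
    Function.injective_id)
  rw [← hcσ] at harr
  refine harr.measure_not_quadratic_bounds_le_exp hc (w := fun _ => (1 : ℝ))
    (fun _ => zero_le_one) (by simpa using hn') hn (by simpa using hT) (fun _ => by simp) ?_
  simp only [one_pow, Finset.sum_const, Finset.card_univ, Fintype.card_fin, nsmul_eq_mul, mul_one,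
    Fintype.card_coe]
  have h1 : 640 * (c : ℝ) ^ 2 * n * (n / (1280 * c ^ 2)) = n ^ 2 / 2 := by
    field_simp
    norm_num
  have h2 := mul_le_mul_of_nonneg_right hT' hn'.le
  rw [mul_add, h1]
  linarith

theorem norm_sum_smul_featureCol_sq (X : Fin n → EuclideanSpace ℝ (Fin M.p))
    (T : Finset (Fin M.p)) (a : Fin M.p → ℝ) :
    ‖∑ j ∈ T, a j • M.featureCol X j‖ ^ 2
      = ∑ i : Fin n, (1 : ℝ) * (∑ j : T, a j * M.featureCol X j i) ^ 2 := by
  rw [EuclideanSpace.norm_sq_eq]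
  refine Finset.sum_congr rfl fun i _ => ?_
  rw [one_mul, Real.norm_eq_abs, sq_abs, Finset.sum_coe_sort T fun j => a j * M.featureCol X j i]
  simp

theorem bounds_of_notMem_illConditioned {K : ℝ} {T : Finset (Fin M.p)}
    {X : Fin n → EuclideanSpace ℝ (Fin M.p)} (hX : X ∉ M.illConditioned n K T) :
    (∀ a : Fin M.p → ℝ, (n : ℝ) / 16 * ∑ j ∈ T, a j ^ 2
        ≤ ‖∑ j ∈ T, a j • M.featureCol X j‖ ^ 2) ∧
      ∀ j ∈ T, ‖M.featureCol X j‖ ^ 2 ≤ K * n := by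
  simp only [illConditioned, Set.mem_ofPred_eq, not_not] at hX
  have hsum : ∑ _i : Fin n, (1 : ℝ) = n := by simp
  rw [hsum] at hX
  have hnorm : ∀ a : Fin M.p → ℝ,
      ‖(WithLp.toLp 2 fun j : T => a j : EuclideanSpace ℝ T)‖ ^ 2 = ∑ j ∈ T, a j ^ 2 := fun a => by
    rw [EuclideanSpace.norm_sq_eq, ← Finset.sum_coe_sort T fun j => a j ^ 2]
    exact Finset.sum_congr rfl fun j _ => by simp
  refine ⟨fun a => ?_, fun j hj => ?_⟩
  · rw [norm_sum_smul_featureCol_sq, ← hnorm]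
    exact (hX (WithLp.toLp 2 fun j : T => a j)).1
  -- The upper bound on a unit coordinate vector is the bound on the norm of a single column.
  · have h := (hX (WithLp.toLp 2 fun k : T => (Pi.single j 1 : Fin M.p → ℝ) k)).2
    rw [hnorm, ← norm_sum_smul_featureCol_sq M X T (Pi.single j 1)] at h
    simpa [Pi.single_apply, hj, ite_smul] using h

theorem card_head {k : ℕ} (hk : k ≤ M.p) : (M.head k).card = k := by
  rw [head, Fin.card_filter_val_lt, min_eq_right hk]

theorem disjoint_head_tail (k : ℕ) : Disjoint (M.head k) (M.tail k) := by
  rw [Finset.disjoint_left]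
  intro j h1 h2
  simp only [head, tail, Finset.mem_filter, Finset.mem_univ, true_and] at h1 h2
  omega

theorem head_union_tail (k : ℕ) : M.head k ∪ M.tail k = Finset.univ := by
  ext j
  simp only [head, tail, Finset.mem_union, Finset.mem_filter, Finset.mem_univ, true_and, iff_true]
  omega

theorem ev_mul_effRank {k : ℕ} (hk : k < M.p) :
    M.ev k * M.effRank k = ∑ j ∈ M.tail k, M.eigval j := by
  have h : 0 < M.ev k := by rw [ev, dif_pos hk]; exact M.eigval_pos _
  rw [effRank]
  field_simp

theorem eigval_le_ev {k : ℕ} (hk : k < M.p) {j : Fin M.p} (hj : j ∈ M.tail k) :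
    M.eigval j ≤ M.ev k := by
  rw [ev, dif_pos hk]
  exact M.eigval_antitone (by simpa [tail, Fin.le_def] using hj)

theorem sum_tail_eigval_pos {k : ℕ} (hk : k < M.p) : 0 < ∑ j ∈ M.tail k, M.eigval j :=
  Finset.sum_pos (fun j _ => M.eigval_pos j) ⟨⟨k, hk⟩, by simp [tail]⟩

/-- The covariates for which the feature columns form a good design with head `k`, and the labels
have the prescribed conditional moments. -/
def goodSet (n k : ℕ) (K : ℝ) : Set (Fin n → EuclideanSpace ℝ (Fin M.p)) :=
  {X | IsGoodDesign (M.featureCol X) M.eigval (fun j => M.coef j ^ 2) (M.head k) (M.tail k) n K ∧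
    M.HasLabelMoments X}

-- Hypothesis `hR` makes the tail operator concentrate on the sphere of `ℝⁿ`; `hk'` makes any `k +
-- 1` columns well-conditioned, which covers the head and the head with one tail column adjoined.
open Classical in
theorem measure_compl_goodSet_le {c : NNReal} (hcσ : c = Real.toNNReal (σx ^ 2)) (hc : 0 < c)
    (hn : 0 < n) {k : ℕ} (hk : k < M.p) (hr : n ≤ M.effRank k) (hkn : k + 1 ≤ n)
    (hk' : 1280 * c ^ 2 * ((k + 1) * Real.log (netBase c)) ≤ n)
    (hR : 640 * c ^ 2 * (∑ j ∈ M.tail k, M.eigval j ^ 2) * (n * Real.log (netBase c) + n)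
      ≤ (∑ j ∈ M.tail k, M.eigval j) ^ 2)
    {a : ℝ} (ha : a ≤ 1) (ha' : a ≤ 1 / (1280 * c ^ 2)) :
    M.designLaw n (M.goodSet n k (56 * c + 1))ᶜ ≤ ENNReal.ofReal (14 * Real.exp (-(a * n))) := by
  have hc' : (0 : ℝ) < c := hc
  have hn' : (0 : ℝ) < n := by exact_mod_cast hn
  have hlog : 0 < Real.log (netBase c) := Real.log_pos (one_lt_netBase hc)
  set P := M.designLaw n
  set S := ∑ j ∈ M.tail k, M.eigval j with hS
  have hSpos : 0 < S := M.sum_tail_eigval_pos hk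
  set e := Real.exp (-(a * n)) with he
  have he0 : 0 < e := Real.exp_pos _
  have he1 : Real.exp (-n) ≤ e := Real.exp_le_exp.2 (by nlinarith)
  have he2 : Real.exp (-(n / (1280 * (c : ℝ) ^ 2))) ≤ e := Real.exp_le_exp.2 (by
    have := mul_le_mul_of_nonneg_right ha' hn'.le
    rw [one_div_mul_eq_div] at this
    linarith)
  have harr := M.isSubgaussianArray_featureCol n
  rw [← hcσ] at harr
  have hle : ∀ j ∈ M.tail k, M.eigval j * n ≤ S := fun j hj => by
    calc M.eigval j * n ≤ M.ev k * M.effRank k :=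
          mul_le_mul (M.eigval_le_ev hk hj) hr hn'.le
            ((M.eigval_pos j).le.trans (M.eigval_le_ev hk hj))
      _ = S := M.ev_mul_effRank hk
  have hsum : ∀ f : Fin M.p → ℝ, ∑ j, (if j ∈ M.tail k then f j else 0) = ∑ j ∈ M.tail k, f j :=
    fun f => by rw [Finset.sum_ite_mem, Finset.univ_inter]
  -- the tail operator
  let w : Fin M.p → ℝ := fun j => if j ∈ M.tail k then M.eigval j else 0
  have hw0 : ∀ j, 0 ≤ w j := fun j => by
    simp only [w]; split_ifs
    exacts [(M.eigval_pos j).le, le_rfl]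
  have hw1 : ∑ j, w j = S := hsum _
  have hw2 : ∑ j, w j ^ 2 = ∑ j ∈ M.tail k, M.eigval j ^ 2 := by
    rw [← hsum]
    exact Finset.sum_congr rfl fun j _ => by simp only [w]; split_ifs <;> simp
  let E₁ : Set (Fin n → EuclideanSpace ℝ (Fin M.p)) :=
    {X | ¬ ∀ u : EuclideanSpace ℝ (Fin n),
        (∑ j, w j) / 16 * ‖u‖ ^ 2 ≤ ∑ j, w j * (∑ i, u i * M.featureCol X j i) ^ 2 ∧
        ∑ j, w j * (∑ i, u i * M.featureCol X j i) ^ 2 ≤ 56 * c * (∑ j, w j) * ‖u‖ ^ 2}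
  have hE₁ : P E₁ ≤ ENNReal.ofReal (2 * e) := by
    refine (harr.measure_not_quadratic_bounds_le_exp hc hw0 (by rw [hw1]; exact hSpos) hn
      (by simp) (fun j => ?_) (τ := n) ?_).trans (ENNReal.ofReal_le_ofReal (by linarith))
    · rw [hw1]
      by_cases hj : j ∈ M.tail k
      · simpa only [w, if_pos hj] using hle j hj
      · simpa only [w, if_neg hj, zero_mul] using hSpos.le
    · rw [hw1, hw2, Fintype.card_fin]; exact hR
  -- the head columns, possibly with one more column
  have hill : ∀ T : Finset (Fin M.p), T.card ≤ k + 1 →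
      P (M.illConditioned n (56 * c) T) ≤ ENNReal.ofReal (2 * e) := fun T hT => by
    refine (M.measure_illConditioned_le hcσ hc hn (hT.trans hkn) (le_trans ?_ hk')).trans
      (ENNReal.ofReal_le_ofReal (by linarith))
    have : (T.card : ℝ) ≤ k + 1 := by exact_mod_cast hT
    gcongr
  have hcard := M.card_head hk.le
  let E₂ := M.illConditioned n (56 * c) (M.head k)
  have hE₂ : P E₂ ≤ ENNReal.ofReal (2 * e) := hill _ (by omega)
  let B : Fin M.p → Set (Fin n → EuclideanSpace ℝ (Fin M.p)) :=
    fun j => M.illConditioned n (56 * c) (insert j (M.head k))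
  have hB : ∀ j, P (B j) ≤ ENNReal.ofReal (2 * e) := fun j =>
    hill _ ((Finset.card_insert_le _ _).trans (by omega))
  -- weighted sums over the tail
  have hnormsq : ∀ X j, ∑ i, M.featureCol X j i ^ 2 = ‖M.featureCol (n := n) X j‖ ^ 2 := fun X j => by
    rw [EuclideanSpace.norm_sq_eq]
    exact Finset.sum_congr rfl fun i _ => by simp
  have hN : ∀ f : Fin M.p → ℝ, (∀ j, 0 ≤ f j) →
      P {X | (56 * c + 1) * n * ∑ j ∈ M.tail k, f j
        < ∑ j ∈ M.tail k, f j * ‖M.featureCol X j‖ ^ 2} ≤ ENNReal.ofReal e := fun f hf => by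
    have hv : ∀ j, 0 ≤ (if j ∈ M.tail k then f j else 0) := fun j => by
      split_ifs
      exacts [hf j, le_rfl]
    refine (measure_mono ?_).trans ((harr.measure_weighted_norm_sq_gt_le hc hv).trans
      (ENNReal.ofReal_le_ofReal (by simpa using he1)))
    intro X hX
    simp only [Set.mem_ofPred_eq, hsum, ite_mul, zero_mul, hnormsq, Fintype.card_fin] at hX ⊢
    refine lt_of_le_of_lt ?_ hX
    have := Finset.sum_nonneg fun j (_ : j ∈ M.tail k) => hf j
    gcongr
    linarith
  have hG : ∀ f : Fin M.p → ℝ, (∀ j, 0 ≤ f j) →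
      P {X | ∑ j ∈ (M.tail k).filter (fun j => X ∉ B j), f j < (∑ j ∈ M.tail k, f j) / 2}
        ≤ ENNReal.ofReal (4 * e) := fun f hf => by
    have hv : ∀ j, 0 ≤ (if j ∈ M.tail k then f j else 0) := fun j => by
      split_ifs
      exacts [hf j, le_rfl]
    refine (measure_mono ?_).trans ((measure_weighted_good_lt_half_le hv hB).trans
      (ENNReal.ofReal_le_ofReal (by linarith)))
    intro X hX
    simp only [Set.mem_ofPred_eq] at hX ⊢
    rw [hsum]
    refine lt_of_eq_of_lt ?_ hX
    rw [Finset.sum_filter, ← hsum]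
    refine Finset.sum_congr rfl fun j _ => ?_
    by_cases h1 : X ∈ B j <;> by_cases h2 : j ∈ M.tail k <;> simp [h1, h2]
  have hlt : ∀ j, 0 ≤ M.eigval j * M.coef j ^ 2 := fun j =>
    mul_nonneg (M.eigval_pos j).le (sq_nonneg _)
  have hN₁ := hN (fun j => M.eigval j ^ 2) fun j => sq_nonneg _
  have hN₂ := hN (fun j => M.eigval j * M.coef j ^ 2) hlt
  have hG₁ := hG M.eigval fun j => (M.eigval_pos j).le
  have hG₂ := hG (fun j => M.coef j ^ 2 * M.eigval j ^ 2) fun j => by positivity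
  have hL : P {X | ¬ M.HasLabelMoments X} = 0 := M.ae_hasLabelMoments
  set A₁ := {X : Fin n → EuclideanSpace ℝ (Fin M.p) |
    (56 * c + 1) * n * ∑ j ∈ M.tail k, M.eigval j ^ 2
        < ∑ j ∈ M.tail k, M.eigval j ^ 2 * ‖M.featureCol X j‖ ^ 2}
  set A₂ := {X : Fin n → EuclideanSpace ℝ (Fin M.p) |
    (56 * c + 1) * n * ∑ j ∈ M.tail k, M.eigval j * M.coef j ^ 2
        < ∑ j ∈ M.tail k, M.eigval j * M.coef j ^ 2 * ‖M.featureCol X j‖ ^ 2}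
  set A₃ := {X : Fin n → EuclideanSpace ℝ (Fin M.p) |
    ∑ j ∈ (M.tail k).filter (fun j => X ∉ B j), M.eigval j < (∑ j ∈ M.tail k, M.eigval j) / 2}
  set A₄ := {X : Fin n → EuclideanSpace ℝ (Fin M.p) |
    ∑ j ∈ (M.tail k).filter (fun j => X ∉ B j), M.coef j ^ 2 * M.eigval j ^ 2
      < (∑ j ∈ M.tail k, M.coef j ^ 2 * M.eigval j ^ 2) / 2}
  set A₅ := {X : Fin n → EuclideanSpace ℝ (Fin M.p) | ¬ M.HasLabelMoments X}
  have hsub : (M.goodSet n k (56 * c + 1))ᶜ ⊆ E₁ ∪ (E₂ ∪ (A₁ ∪ (A₂ ∪ (A₃ ∪ (A₄ ∪ A₅))))) := by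
    intro X hX
    by_contra hno
    simp only [Set.mem_union, not_or] at hno
    obtain ⟨h1, h2, h3, h4, h5, h6, h7⟩ := hno
    apply hX
    simp only [A₁, A₂, A₃, A₄, A₅, E₁, Set.mem_ofPred_eq, not_not, not_lt] at h1 h3 h4 h5 h6 h7
    obtain ⟨h2, h2'⟩ := M.bounds_of_notMem_illConditioned h2
    have hform : ∀ u, ∑ j, w j * (∑ i, u i * M.featureCol X j i) ^ 2
        = ∑ j ∈ M.tail k, M.eigval j * ⟪M.featureCol X j, u⟫_ℝ ^ 2 := fun u => by
      rw [← hsum]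
      refine Finset.sum_congr rfl fun j _ => ?_
      simp only [w, M.inner_featureCol, ite_mul, zero_mul]
    simp only [hw1, hform] at h1
    have hKn : 56 * c * n ≤ (56 * c + 1) * (n : ℝ) := by nlinarith
    refine ⟨⟨M.disjoint_head_tail k, M.head_union_tail k, M.eigval_pos, fun j => sq_nonneg _, hn',
      by linarith, hSpos, hle, fun u => (h1 u).1, fun u => (h1 u).2.trans ?_, h2,
      fun i hi => (h2' i hi).trans hKn, h3, h4,
      ⟨(M.tail k).filter (fun j => X ∉ B j), Finset.filter_subset _ _, fun j hj => ?_, h5, h6⟩⟩,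
      h7⟩
    · gcongr
      linarith
    · obtain ⟨h8, h9⟩ := M.bounds_of_notMem_illConditioned (Finset.mem_filter.1 hj).2
      exact ⟨(h9 j (Finset.mem_insert_self _ _)).trans hKn, h8⟩
  refine (measure_mono hsub).trans ?_
  -- The shares are `2` for the tail operator, `2` for the head, `1` for each of two column-norm
  -- averages, `4` for each of two good-weight statements, and `0` for the label moments.
  have hfin : ENNReal.ofReal (14 * e) = ENNReal.ofReal (2 * e) + (ENNReal.ofReal (2 * e) +
      (ENNReal.ofReal e + (ENNReal.ofReal e + (ENNReal.ofReal (4 * e) +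
        (ENNReal.ofReal (4 * e) + 0))))) := by
    rw [add_zero]
    repeat rw [← ENNReal.ofReal_add (by positivity) (by positivity)]
    congr 1
    ring
  rw [hfin]
  refine (measure_union_le _ _).trans (add_le_add hE₁ ?_)
  refine (measure_union_le _ _).trans (add_le_add hE₂ ?_)
  refine (measure_union_le _ _).trans (add_le_add hN₁ ?_)
  refine (measure_union_le _ _).trans (add_le_add hN₂ ?_)
  refine (measure_union_le _ _).trans (add_le_add hG₁ ?_)
  exact (measure_union_le _ _).trans (add_le_add hG₂ hL.le)

/-! ### The bounds on a good design -/

variable {M}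

theorem bounds_of_mem_goodSet {k : ℕ} (hk : k < M.p) {K : ℝ}
    {X : Fin n → EuclideanSpace ℝ (Fin M.p)} (hX : X ∈ M.goodSet n k K) {lam : ℝ}
    (hlam : 0 ≤ lam) :
    M.stdRisk X (ridge X lam) ≤ 1122 * K ^ 2 * M.riskBound n k lam ∧
      1 / (4096 * K ^ 3) * M.normBound n k lam ≤ M.sqNorm X (ridge X lam) := by
  obtain ⟨hgood, hlab⟩ := hX
  have hμ : 0 ≤ (n : ℝ) * lam := by positivity
  -- Even without ridge penalty the tail alone makes the Gram operator positive definite.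
  have hpos : ∀ u, u ≠ 0 →
      gramOp (M.featureCol X) M.eigval Finset.univ (n * lam) u ≠ 0 := by
    intro u hu h0
    have h1 : ⟪u, gramOp (M.featureCol X) M.eigval Finset.univ (n * lam) u⟫_ℝ = 0 := by
      rw [h0, inner_zero_right]
    have h2 := hgood.tail_lower u
    have h3 := hgood.trace_pos
    have h4 : 0 < ‖u‖ := norm_pos_iff.2 hu
    rw [inner_gramOp_self, ← M.head_union_tail k, Finset.sum_union (M.disjoint_head_tail k)] at h1
    have h5 : 0 ≤ ∑ j ∈ M.head k, M.eigval j * ⟪M.featureCol X j, u⟫_ℝ ^ 2 :=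
      Finset.sum_nonneg fun j _ => mul_nonneg (M.eigval_pos j).le (sq_nonneg _)
    have h6 : 0 < (∑ j ∈ M.tail k, M.eigval j) / 16 * ‖u‖ ^ 2 := by positivity
    have h7 : 0 ≤ (n : ℝ) * lam * ‖u‖ ^ 2 := by positivity
    linarith
  obtain ⟨q, hq, hr⟩ := M.exists_inner_ridge_eq X lam hpos
  rw [stdRisk_ridge_eq hlab hq hr, sqNorm_ridge_eq hlab hq hr]
  have h1 := hgood.risk_le hμ hq M.noiseVar_pos.le
  have h2 := hgood.le_norm hμ hq M.noiseVar_pos.le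
  rw [M.card_head hk.le] at h1
  simp only [riskBound, normBound, M.ev_mul_effRank hk, tailNormSq, headNormSq]
  simp only [mul_pow] at h1 h2
  exact ⟨h1, h2⟩

end RegressionModel

/-! ### Benign overfitting bounds -/

/-- Measurability of the good set is avoided by passing to the complement of a measurable hull of
its complement. -/
theorem exists_measurableSet_of_measure_compl_lt {Ω : Type*} [MeasurableSpace Ω] {P : Measure Ω}
    [IsProbabilityMeasure P] {G : Set Ω} {δ : ℝ} (hδ : 0 ≤ δ) (hG : P Gᶜ ≤ ENNReal.ofReal δ) :
    ∃ E, MeasurableSet E ∧ ENNReal.ofReal (1 - δ) ≤ P E ∧ E ⊆ G := by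
  refine ⟨(toMeasurable P Gᶜ)ᶜ, (measurableSet_toMeasurable _ _).compl, ?_, fun ω hω => ?_⟩
  · rw [prob_compl_eq_one_sub (measurableSet_toMeasurable _ _), measure_toMeasurable,
      ENNReal.ofReal_sub _ hδ, ENNReal.ofReal_one]
    gcongr
  · by_contra h
    exact hω (subset_toMeasurable _ _ h)

theorem BenignOverfitting.eventually_measure_compl_goodSet_le {b σx : ℝ} (hb : 1 < b)
    {M : ℕ → RegressionModel σx} (hM : BenignOverfitting M b) {c : NNReal}
    (hcσ : c = Real.toNNReal (σx ^ 2)) (hc : 0 < c) {a : ℝ} (ha : a ≤ 1)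
    (ha' : a ≤ 1 / (1280 * c ^ 2)) :
    ∀ᶠ n : ℕ in atTop, (M n).critIndex b n < (M n).p ∧
      (M n).designLaw n ((M n).goodSet n ((M n).critIndex b n) (56 * c + 1))ᶜ
        ≤ ENNReal.ofReal (14 * Real.exp (-(a * n))) := by
  have hc' : (0 : ℝ) < c := hc
  have hlog : 0 < Real.log (netBase c) := Real.log_pos (one_lt_netBase hc)
  -- `(k + 1)/n < κ` yields at once `k + 1 ≤ n` and the conditioning requirement on `k + 1` columns;
  -- `n / R_k < ρ` is the requirement on the tail.
  set κ : ℝ := 1 / (1 + 1280 * c ^ 2 * Real.log (netBase c)) with hκ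
  have hκ0 : 0 < κ := by positivity
  set ρ : ℝ := 1 / (640 * c ^ 2 * (Real.log (netBase c) + 1)) with hρ
  have hρ0 : 0 < ρ := by positivity
  have hcrit : Tendsto (fun n : ℕ => ((M n).critIndex b n : ℝ) / n + 1 / n) atTop (𝓝 0) := by
    simpa using hM.crit_tendsto.add tendsto_one_div_atTop_nhds_zero_nat
  filter_upwards [hM.crit_nonempty, hcrit.eventually_lt_const hκ0,
    hM.rank_tendsto.eventually_lt_const hρ0, eventually_gt_atTop 0] with n hne h1 h2 hn
  have hn' : (0 : ℝ) < n := by exact_mod_cast hn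
  obtain ⟨hk, hbk⟩ := Nat.sInf_mem hne
  change (M n).critIndex b n < (M n).p at hk
  change b * n ≤ (M n).effRank ((M n).critIndex b n) at hbk
  set k := (M n).critIndex b n
  refine ⟨hk, ?_⟩
  rw [← add_div, div_lt_iff₀ hn', hκ, div_mul_eq_mul_div, one_mul, lt_div_iff₀ (by positivity)] at h1
  have hV : 0 < ∑ j ∈ (M n).tail k, (M n).eigval j ^ 2 :=
    Finset.sum_pos (fun j _ => pow_pos ((M n).eigval_pos j) 2)
      ⟨⟨k, hk⟩, by simp [RegressionModel.tail]⟩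
  have hW := (M n).sum_tail_eigval_pos hk
  rw [RegressionModel.effRank', hρ, div_div_eq_mul_div, div_lt_iff₀ (by positivity),
    div_mul_eq_mul_div, one_mul, lt_div_iff₀ (by positivity)] at h2
  have hx : 0 ≤ 1280 * (c : ℝ) ^ 2 * Real.log (netBase c) := by positivity
  have hk0 : (0 : ℝ) ≤ k + 1 := by positivity
  refine (M n).measure_compl_goodSet_le hcσ hc hn hk ?_ ?_ ?_ ?_ ha ha'
  · nlinarith
  · have : ((k + 1 : ℕ) : ℝ) ≤ n := by push_cast; nlinarith
    exact_mod_cast this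
  · nlinarith
  · linarith

theorem theorem5 (b σx : ℝ) (hb : 1 < b) (hσx : 0 < σx) :
    ∃ C₁ > (0 : ℝ), ∃ C₂ > (0 : ℝ), ∃ c > (1 : ℝ),
      ∀ M : ℕ → RegressionModel σx, BenignOverfitting M b →
        ∀ᶠ n : ℕ in atTop, ∀ δ : ℝ, 0 < δ → δ < 1 → Real.log (1 / δ) < n / c →
          ∃ E : Set (Fin n → EuclideanSpace ℝ (Fin (M n).p)), MeasurableSet E ∧
            ENNReal.ofReal (1 - δ) ≤ (M n).designLaw n E ∧
            ∀ X ∈ E, ∀ lam : ℝ, 0 ≤ lam →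
              (M n).stdRisk X (ridge X lam) / C₁
                ≤ (M n).riskBound n ((M n).critIndex b n) lam ∧
              (M n).normBound n ((M n).critIndex b n) lam
                ≤ (M n).sqNorm X (ridge X lam) / C₂ := by
  obtain ⟨c, hcσ⟩ : ∃ c : NNReal, c = Real.toNNReal (σx ^ 2) := ⟨_, rfl⟩
  have hc : 0 < c := by rw [hcσ]; exact Real.toNNReal_pos.2 (by positivity)
  have hc' : (0 : ℝ) < c := hc
  set a : ℝ := min 1 (1 / (1280 * c ^ 2)) with ha
  have ha0 : 0 < a := by positivity
  have ha1 : a ≤ 1 := min_le_left _ _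
  -- The design constant is `K = 56 c + 1`, where the summand `1` ensures `K ≥ 1`. The theorem's
  -- constant `2 / a` claims only half of the exponential rate `a`; the other half absorbs the
  -- factor `14` for large `n`.
  refine ⟨1122 * (56 * c + 1) ^ 2, by positivity, 1 / (4096 * (56 * c + 1) ^ 3), by positivity,
    2 / a, by rw [gt_iff_lt, lt_div_iff₀ ha0]; linarith, fun M hM => ?_⟩
  have hexp : Tendsto (fun n : ℕ => 14 * Real.exp (-(a / 2 * n))) atTop (𝓝 0) := by
    have h1 : Tendsto (fun n : ℕ => a / 2 * (n : ℝ)) atTop atTop :=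
      tendsto_natCast_atTop_atTop.const_mul_atTop (by positivity)
    simpa using (Real.tendsto_exp_neg_atTop_nhds_zero.comp h1).const_mul 14
  filter_upwards [hM.eventually_measure_compl_goodSet_le hb hcσ hc ha1 (min_le_right _ _),
    hexp.eventually_lt_const zero_lt_one] with n ⟨hk, hmeas⟩ hsmall δ hδ0 hδ1 hδ
  have hδ' : 14 * Real.exp (-(a * n)) ≤ δ := by
    have h1 : Real.exp (-(a / 2 * n)) ≤ δ := by
      rw [one_div, Real.log_inv, div_div_eq_mul_div] at hδ
      rw [← Real.log_le_log_iff (Real.exp_pos _) hδ0, Real.log_exp]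
      linarith
    have h2 : Real.exp (-(a * n)) = Real.exp (-(a / 2 * n)) * Real.exp (-(a / 2 * n)) := by
      rw [← Real.exp_add]; congr 1; ring
    rw [h2]
    nlinarith [Real.exp_pos (-(a / 2 * n))]
  obtain ⟨E, hE, hPE, hsub⟩ := exists_measurableSet_of_measure_compl_lt hδ0.le
    (hmeas.trans (ENNReal.ofReal_le_ofReal hδ'))
  refine ⟨E, hE, hPE, fun X hX lam hlam => ?_⟩
  obtain ⟨h1, h2⟩ := RegressionModel.bounds_of_mem_goodSet hk (hsub hX) hlam
  refine ⟨?_, ?_⟩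
  · rw [div_le_iff₀ (by positivity), mul_comm]
    exact h1
  · rw [le_div_iff₀ (by positivity), mul_comm]
    exact h2
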